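/- Let $\mathbb H$ be the quaternions, let $\operatorname{Im}\mathbb H\cong\mathbb R^3$, and let \[\mathbb R^{4,1}=\Big\{X=\begin{pmatrix}x&x_\infty\\x_0&-x\end{pmatrix}\ \Big|\ x\in\operatorname{Im}\mathbb H,\ x_0,x_\infty\in\mathbb R\Big\},\qquad \langle X,Y\rangle\cdot I=-\tfrac12(XY+YX),\] with light cone $L^4=\{X\in\mathbb R^{4,1}\mid\langle X,X\rangle=0\}$. A nonzero $Q\in\mathbb R^{4,1}$ determines the space form $M=\{X\in L^4\mid\langle X,Q\rangle=-1\}$, with the metric induced from $\mathbb R^{4,1}$. Let $U\subset\mathbb R^2$ be open and connected, and let $x=x(u,v):U\to\operatorname{Im}\mathbb H$ be a smooth immersion without umbilic points for which $(u,v)$ are isothermic coordinates, i.e. conformal curvature-line coordinates. Let $Q\in\mathbb R^{4,1}$ be nonzero and suppose that $x$ gives a surface in the corresponding space form $M$, i.e. that $\langle\hat x,Q\rangle\neq0$ on $U$, where $\hat x=\begin{pmatrix}x&-x^2\\1&-x\end{pmatrix}$; this surface is $X=-\langle\hat x,Q\rangle^{-1}\hat x:U\to M$. A (local) Christoffel transform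 of $x$ is an $\operatorname{Im}\mathbb H$-valued map $x^*$ with $dx^*=x_u^{-1}du-x_v^{-1}dv$ (quaternionic inverses). Put \[\tau=\begin{pmatrix}x\,dx^*&-x\,dx^*\,x\\dx^*&-dx^*\,x\end{pmatrix};\] only $dx^*$ enters here, so that $\tau$ is a well-defined $1$-form on $U$ whenever Christoffel transforms exist near each point of $U$. For smooth $\tilde Q,Z:U\to\mathbb R^{4,1}$ one calls $\tilde Q+\lambda Z$ a linear conserved quantity of $x$ if Christoffel transforms of $x$ exist near each point of $U$ and \[d(\tilde Q+\lambda Z)=(\tilde Q+\lambda Z)\lambda\tau-\lambda\tau(\tilde Q+\lambda Z)\qquad\text{for all }\lambda\in\mathbb R.\] Then the surface $X$ has constant mean curvature in $M$ if and only if there exists a smooth $Z:U\to\mathbb R^{4,1}$ such that, for the given constant $Q$, $Q+\lambda Z$ is a linear conserved quantity of $x$. -/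

import Mathlib

open scoped Quaternion ContDiff

noncomputable section

namespace Isothermic

-- A norm on `2 × 2` quaternionic matrices, used only to differentiate matrix-valued maps (the
-- space is finite-dimensional over `ℝ`, so derivatives do not depend on the choice of the norm).
attribute [local instance] Matrix.normedAddCommGroup Matrix.normedSpace

/-- `2 × 2` matrices of quaternions. -/
abbrev Mat : Type := Matrix (Fin 2) (Fin 2) ℍ[ℝ]

/-! ### Minkowski space `ℝ^{4,1}`, the light cone and the space forms -/

/-- Minkowski 5-space: the real subspace of the matrices `(x, x_∞; x_0, -x)` with `x` an imaginary
quaternion and `x_0`, `x_∞` real. -/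
def R41 : Submodule ℝ Mat where
  carrier := {X | ∃ (x : ℍ[ℝ]) (x0 xinf : ℝ), x.re = 0 ∧ X = !![x, (xinf : ℍ[ℝ]); (x0 : ℍ[ℝ]), -x]}
  add_mem' := by
    rintro _ _ ⟨x, a, b, hx, rfl⟩ ⟨y, c, d, hy, rfl⟩
    refine ⟨x + y, a + c, b + d, by simp [hx, hy], ?_⟩
    ext i j <;> fin_cases i <;> fin_cases j <;> simp <;> ring
  zero_mem' := by
    refine ⟨0, 0, 0, by simp, ?_⟩
    ext i j <;> fin_cases i <;> fin_cases j <;> simp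
  smul_mem' := by
    rintro r _ ⟨x, a, b, hx, rfl⟩
    refine ⟨r • x, r * a, r * b, by simp [hx], ?_⟩
    ext i j <;> fin_cases i <;> fin_cases j <;> simp

/-- The Minkowski product, determined by `⟨X, Y⟩ I = -(XY + YX) / 2`
(see `minkInner_smul_one`). -/
def minkInner (X Y : Mat) : ℝ := (((-(1 / 2) : ℝ) • (X * Y + Y * X)) 0 0).re

theorem minkInner_smul_one {X Y : Mat} (hX : X ∈ R41) (hY : Y ∈ R41) :
    minkInner X Y • (1 : Mat) = (-(1 / 2) : ℝ) • (X * Y + Y * X) := by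
  obtain ⟨x, a, b, hx, rfl⟩ := hX
  obtain ⟨y, c, d, hy, rfl⟩ := hY
  ext i j <;> fin_cases i <;> fin_cases j <;>
    simp [minkInner, hx, hy] <;> ring

/-- The light cone of `ℝ^{4,1}`. -/
def lightCone : Set Mat := {X | X ∈ R41 ∧ minkInner X X = 0}

/-- The space form `M = {X ∈ L⁴ | ⟨X, Q⟩ = -1}`. -/
def spaceForm (Q : Mat) : Set Mat := {X | X ∈ lightCone ∧ minkInner X Q = -1}

/-- The light-like vector `(x, -x²; 1, -x)` that represents the point `x ∈ Im ℍ = ℝ³`. -/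
def pointLift (x : ℍ[ℝ]) : Mat := !![x, -(x * x); 1, -x]

/-- The real multiple of `pointLift x` that lies in the space form of `Q`. It exists if and only if
`⟨pointLift x, Q⟩ ≠ 0`, that is, if and only if the value of this map lies in `spaceForm Q`. -/
def spaceFormLift (Q : Mat) (x : ℍ[ℝ]) : Mat := (-(minkInner (pointLift x) Q)⁻¹) • pointLift x

/-! ### Surfaces in `Im ℍ = ℝ³` -/

/-- The partial derivative in the first coordinate `u`. -/
def pdu {E : Type*} [NormedAddCommGroup E] [NormedSpace ℝ E] (f : ℝ × ℝ → E) (p : ℝ × ℝ) : E :=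
  fderiv ℝ f p (1, 0)

/-- The partial derivative in the second coordinate `v`. -/
def pdv {E : Type*} [NormedAddCommGroup E] [NormedSpace ℝ E] (f : ℝ × ℝ → E) (p : ℝ × ℝ) : E :=
  fderiv ℝ f p (0, 1)

/-- The vector product of imaginary quaternions. -/
def cross (a b : ℍ[ℝ]) : ℍ[ℝ] := (1 / 2 : ℝ) • (a * b - b * a)

/-- The Euclidean unit normal `n₀ = (x_u × x_v) / |x_u × x_v|`. -/
def euclNormal (x : ℝ × ℝ → ℍ[ℝ]) (p : ℝ × ℝ) : ℍ[ℝ] :=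
  ‖cross (pdu x p) (pdv x p)‖⁻¹ • cross (pdu x p) (pdv x p)

/-- The point `p` is umbilic: the second fundamental form of `x` in `ℝ³` is a multiple `k` of the
first one there, that is, the two principal curvatures agree. -/
def IsUmbilic (x : ℝ × ℝ → ℍ[ℝ]) (p : ℝ × ℝ) : Prop :=
  ∃ k : ℝ,
    inner ℝ (pdu (pdu x) p) (euclNormal x p) = k * inner ℝ (pdu x p) (pdu x p) ∧
    inner ℝ (pdu (pdv x) p) (euclNormal x p) = k * inner ℝ (pdu x p) (pdv x p) ∧
    inner ℝ (pdv (pdv x) p) (euclNormal x p) = k * inner ℝ (pdv x p) (pdv x p)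

/-- `x : U → Im ℍ = ℝ³` is a smooth immersion, and the coordinates `(u, v)` of `U` are isothermic
for it: conformal curvature-line coordinates. -/
structure IsIsothermicImmersion (U : Set (ℝ × ℝ)) (x : ℝ × ℝ → ℍ[ℝ]) : Prop where
  smooth : ContDiffOn ℝ ∞ x U
  imaginary : ∀ p ∈ U, (x p).re = 0
  immersion : ∀ p ∈ U, Function.Injective (fderiv ℝ x p)
  norm_eq : ∀ p ∈ U, ‖pdu x p‖ = ‖pdv x p‖
  orthogonal : ∀ p ∈ U, inner ℝ (pdu x p) (pdv x p) = 0
  curvatureLine : ∀ p ∈ U, inner ℝ (pdu (pdv x) p) (euclNormal x p) = 0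

/-! ### The Christoffel transform and linear conserved quantities -/

/-- The 1-form `x_u⁻¹ du - x_v⁻¹ dv`, with quaternionic inverses. -/
def christoffelForm (x : ℝ × ℝ → ℍ[ℝ]) (p : ℝ × ℝ) : ℝ × ℝ →L[ℝ] ℍ[ℝ] :=
  (ContinuousLinearMap.fst ℝ ℝ ℝ).smulRight (pdu x p)⁻¹ -
    (ContinuousLinearMap.snd ℝ ℝ ℝ).smulRight (pdv x p)⁻¹

/-- On the open set `V`, `xs` is a Christoffel transform `x*` of `x`: a map into `Im ℍ` with
`dx* = x_u⁻¹ du - x_v⁻¹ dv`. -/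
def IsChristoffelTransform (V : Set (ℝ × ℝ)) (x xs : ℝ × ℝ → ℍ[ℝ]) : Prop :=
  ∀ p ∈ V, (xs p).re = 0 ∧ HasFDerivAt xs (christoffelForm x p) p

/-- The matrix-valued 1-form `τ = (x dx*, -x dx* x; dx*, -dx* x)` at `p`, applied to `w`. -/
def tau (x xs : ℝ × ℝ → ℍ[ℝ]) (p w : ℝ × ℝ) : Mat :=
  !![x p * fderiv ℝ xs p w, -(x p * fderiv ℝ xs p w * x p);
    fderiv ℝ xs p w, -(fderiv ℝ xs p w * x p)]

/-- `Q + λ Z` is a linear conserved quantity of `x` on the open set `U`: the maps `Q` and `Z` from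
`U` to `ℝ^{4,1}` are smooth and `d(Q + λ Z) = (Q + λ Z) λ τ - λ τ (Q + λ Z)` for all real `λ`.
The Christoffel transform `x*` behind `τ` is taken in a neighbourhood of each point; only `dx*`
enters, and it does not depend on the choice of `x*`. -/
structure IsLinearConservedQuantity (U : Set (ℝ × ℝ)) (x : ℝ × ℝ → ℍ[ℝ]) (Q Z : ℝ × ℝ → Mat) :
    Prop where
  smooth_Q : ContDiffOn ℝ ∞ Q U
  smooth_Z : ContDiffOn ℝ ∞ Z U
  mem_Q : ∀ p ∈ U, Q p ∈ R41
  mem_Z : ∀ p ∈ U, Z p ∈ R41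
  conserved : ∀ p₀ ∈ U, ∃ V : Set (ℝ × ℝ), IsOpen V ∧ p₀ ∈ V ∧ V ⊆ U ∧
    ∃ xs : ℝ × ℝ → ℍ[ℝ], IsChristoffelTransform V x xs ∧
      ∀ p ∈ V, ∀ w : ℝ × ℝ, ∀ l : ℝ,
        fderiv ℝ (fun q => Q q + l • Z q) p w =
          (Q p + l • Z p) * (l • tau x xs p w) - (l • tau x xs p w) * (Q p + l • Z p)

/-! ### Mean curvature in a space form -/

/-- `N` is a smooth unit normal field of the surface `X` in the space form of `Q`. The tangent
space of the space form at a point `Y` is the orthogonal complement of `Y` and `Q`. -/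
structure IsUnitNormal (U : Set (ℝ × ℝ)) (Q : Mat) (X N : ℝ × ℝ → Mat) : Prop where
  smooth : ContDiffOn ℝ ∞ N U
  mem : ∀ p ∈ U, N p ∈ R41
  tangent : ∀ p ∈ U, minkInner (N p) (X p) = 0 ∧ minkInner (N p) Q = 0
  normal : ∀ p ∈ U, minkInner (N p) (pdu X p) = 0 ∧ minkInner (N p) (pdv X p) = 0
  unit : ∀ p ∈ U, minkInner (N p) (N p) = 1

/-- The mean curvature `(b₁₁ g₂₂ - 2 b₁₂ g₁₂ + b₂₂ g₁₁) / (2 (g₁₁ g₂₂ - g₁₂²))`, half the trace of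
the shape operator, of a surface `X` in a space form with unit normal `N`. As `N` is tangent to the
space form, the second fundamental form is given by the products of `N` with the second
derivatives of `X` in `ℝ^{4,1}`. -/
def meanCurvature (X N : ℝ × ℝ → Mat) (p : ℝ × ℝ) : ℝ :=
  (minkInner (pdu (pdu X) p) (N p) * minkInner (pdv X p) (pdv X p)
      - 2 * minkInner (pdu (pdv X) p) (N p) * minkInner (pdu X p) (pdv X p)
      + minkInner (pdv (pdv X) p) (N p) * minkInner (pdu X p) (pdu X p)) /
    (2 * (minkInner (pdu X p) (pdu X p) * minkInner (pdv X p) (pdv X p)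
      - minkInner (pdu X p) (pdv X p) ^ 2))

/-- The surface `X` in the space form of `Q` has constant mean curvature. -/
def HasConstantMeanCurvature (U : Set (ℝ × ℝ)) (Q : Mat) (X : ℝ × ℝ → Mat) : Prop :=
  ∃ N : ℝ × ℝ → Mat, IsUnitNormal U Q X N ∧ ∃ c : ℝ, ∀ p ∈ U, meanCurvature X N p = c

end Isothermic

end

noncomputable section

namespace Isothermic

attribute [local instance] Matrix.normedAddCommGroup Matrix.normedSpace

/-! ### Algebra of imaginary quaternions -/

/-! Write `x̂` for `pointLift x` and `X` for the surface in the space form. Commuting with `τ` is an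
infinitesimal rotation of `ℝ^{4,1}`: if `η` is the value of `dx*` and `T` its tangent lift at `x`,
then `Yτ - τY = 2⟨Y, T⟩ x̂ - 2⟨Y, x̂⟩ T` (`commutator_tauValue`). Comparing powers of `λ`, the
conservation law says `[Z, τ] = 0` and `dZ = [Q, τ]`. The first equation means that `Z` is
orthogonal to `X`, `X_u`, `X_v` (`commutator_eq_zero_iff`). The second, by `⟨X, Q⟩ = -1`, becomes
`Z_u = -2 X_u / |X_u|²` and `Z_v = 2 X_v / |X_v|²` (`commutator_inv_dd`). So `Z` is a dual of `X`
that is also normal to it (`IsDualField`), and the theorem reduces to: `X` has constant mean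
curvature iff such a field exists. Local Christoffel transforms exist because the form `x_u⁻¹ du -
x_v⁻¹ dv` is closed in curvature-line coordinates (`exists_isChristoffelTransform`).

Let `X` have unit normal `N`, principal curvatures `k₁`, `k₂` and constant mean curvature `c`. Since
`N_u = -k₁ X_u` and `N_v = -k₂ X_v` (`dd_unitNormal_eq`), the derivatives of `N + cX` are `-(k₁ - c)
X_u` and `(k₁ - c) X_v`. A Codazzi argument makes `m = (k₁ - c)|X_u|²` constant
(`exists_minkInner_dd_eq_const`). It is nonzero because there are no umbilics, and `Z = (2/m)(N +
cX)` is the dual field (`exists_isDualField`).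

Conversely, for a dual field `⟨Z, Z⟩` and `b = ⟨Z, Q⟩` are constant, and `Z + bX` is a normal field
in the space form of constant positive length. The opposite signs of `Z_u` and `Z_v` cancel in the
trace of the second fundamental form, so only the constant contribution of `bX` is left
(`hasConstantMeanCurvature_of_isDualField`). -/

theorem inner_eq_components (a b : ℍ[ℝ]) :
    inner ℝ a b = a.re * b.re + a.imI * b.imI + a.imJ * b.imJ + a.imK * b.imK := by
  rw [Quaternion.inner_def, Quaternion.re_mul]; simp

@[simp] theorem cross_re (a b : ℍ[ℝ]) : (cross a b).re = 0 := by
  simp [cross]; ring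
@[simp] theorem cross_imI (a b : ℍ[ℝ]) : (cross a b).imI = a.imJ * b.imK - a.imK * b.imJ := by
  simp [cross]; ring
@[simp] theorem cross_imJ (a b : ℍ[ℝ]) : (cross a b).imJ = a.imK * b.imI - a.imI * b.imK := by
  simp [cross]; ring
@[simp] theorem cross_imK (a b : ℍ[ℝ]) : (cross a b).imK = a.imI * b.imJ - a.imJ * b.imI := by
  simp [cross]; ring

theorem inner_cross_left (a b : ℍ[ℝ]) : inner ℝ a (cross a b) = 0 := by
  simp [inner_eq_components]; ring

theorem inner_cross_right (a b : ℍ[ℝ]) : inner ℝ b (cross a b) = 0 := by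
  simp [inner_eq_components]; ring

theorem inner_cross_self {a b : ℍ[ℝ]} (ha : a.re = 0) (hb : b.re = 0) :
    inner ℝ (cross a b) (cross a b) = inner ℝ a a * inner ℝ b b - inner ℝ a b ^ 2 := by
  simp only [inner_eq_components, cross_re, cross_imI, cross_imJ, cross_imK, ha, hb]; ring

/-- An imaginary quaternion orthogonal to `a`, `b` and `a × b` vanishes. -/
theorem eq_zero_of_inner_eq_zero {a b q : ℍ[ℝ]} (ha : a.re = 0) (hb : b.re = 0) (hq : q.re = 0)
    (hab : cross a b ≠ 0) (h₁ : inner ℝ q a = 0) (h₂ : inner ℝ q b = 0)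
    (h₃ : inner ℝ q (cross a b) = 0) : q = 0 := by
  have hc : inner ℝ (cross a b) (cross a b) ≠ 0 := inner_self_ne_zero.mpr hab
  simp only [inner_eq_components, cross_re, cross_imI, cross_imJ, cross_imK, ha, hb, hq] at hc h₁ h₂ h₃
  ext
  · exact hq
  -- Componentwise, with `c = a × b`: `|c|² q = ⟨q, a⟩ (b × c) + ⟨q, b⟩ (c × a) + ⟨q, c⟩ c`. The
  -- coefficients below are the components of these three vectors.
  · refine (mul_eq_zero.mp ?_).resolve_right hc
    linear_combination
      (b.imJ * (a.imI * b.imJ - a.imJ * b.imI) - b.imK * (a.imK * b.imI - a.imI * b.imK)) * h₁ +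
      ((a.imK * b.imI - a.imI * b.imK) * a.imK - (a.imI * b.imJ - a.imJ * b.imI) * a.imJ) * h₂ +
      (a.imJ * b.imK - a.imK * b.imJ) * h₃
  · refine (mul_eq_zero.mp ?_).resolve_right hc
    linear_combination
      (b.imK * (a.imJ * b.imK - a.imK * b.imJ) - b.imI * (a.imI * b.imJ - a.imJ * b.imI)) * h₁ +
      ((a.imI * b.imJ - a.imJ * b.imI) * a.imI - (a.imJ * b.imK - a.imK * b.imJ) * a.imK) * h₂ +
      (a.imK * b.imI - a.imI * b.imK) * h₃
  · refine (mul_eq_zero.mp ?_).resolve_right hc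
    linear_combination
      (b.imI * (a.imK * b.imI - a.imI * b.imK) - b.imJ * (a.imJ * b.imK - a.imK * b.imJ)) * h₁ +
      ((a.imJ * b.imK - a.imK * b.imJ) * a.imJ - (a.imK * b.imI - a.imI * b.imK) * a.imI) * h₂ +
      (a.imI * b.imJ - a.imJ * b.imI) * h₃

/-- An imaginary quaternion orthogonal to `a` and `b` is a multiple of `a × b`. -/
theorem exists_eq_smul_cross {a b q : ℍ[ℝ]} (ha : a.re = 0) (hb : b.re = 0) (hq : q.re = 0)
    (hab : cross a b ≠ 0) (h₁ : inner ℝ q a = 0) (h₂ : inner ℝ q b = 0) :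
    ∃ s : ℝ, q = s • cross a b := by
  have hc : inner ℝ (cross a b) (cross a b) ≠ 0 := inner_self_ne_zero.mpr hab
  refine ⟨inner ℝ q (cross a b) / inner ℝ (cross a b) (cross a b), sub_eq_zero.mp ?_⟩
  refine eq_zero_of_inner_eq_zero ha hb (by simp [hq]) hab ?_ ?_ ?_
  · rw [inner_sub_left, real_inner_smul_left, h₁, real_inner_comm a, inner_cross_left]
    simp
  · rw [inner_sub_left, real_inner_smul_left, h₂, real_inner_comm b, inner_cross_right]
    simp
  · rw [inner_sub_left, real_inner_smul_left, div_mul_cancel₀ _ hc, sub_self]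

theorem mul_add_mul_eq {a b : ℍ[ℝ]} (ha : a.re = 0) (hb : b.re = 0) :
    a * b + b * a = ((-2 * inner ℝ a b : ℝ) : ℍ[ℝ]) := by
  rw [inner_eq_components]
  ext <;> simp [ha, hb] <;> ring

theorem inv_eq_neg_smul {a : ℍ[ℝ]} (ha : a.re = 0) : a⁻¹ = -(inner ℝ a a)⁻¹ • a := by
  have hs : star a = -a := by ext <;> simp [ha]
  rw [Quaternion.inv_def, hs, Quaternion.inner_self]
  simp

/-- For orthogonal imaginary `a`, `b` of the same length and `q` in their span, the sandwich
products of `q` with `a⁻¹` and with `b⁻¹` cancel. -/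
theorem inv_mul_mul_inv_add {a b q : ℍ[ℝ]} (ha : a.re = 0) (hb : b.re = 0) (hq : q.re = 0)
    (hab : cross a b ≠ 0) (hE : inner ℝ a a = inner ℝ b b) (h : inner ℝ a b = 0)
    (h₃ : inner ℝ q (cross a b) = 0) :
    a⁻¹ * q * a⁻¹ + b⁻¹ * q * b⁻¹ = 0 := by
  have hc : inner ℝ (cross a b) (cross a b) ≠ 0 := inner_self_ne_zero.mpr hab
  have hbb : inner ℝ b b ≠ 0 := by
    intro h0
    rw [inner_cross_self ha hb, h0, h] at hc; simp at hc
  obtain ⟨s, t, rfl⟩ : ∃ s t : ℝ, q = s • a + t • b := by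
    refine ⟨inner ℝ q a / inner ℝ b b, inner ℝ q b / inner ℝ b b, sub_eq_zero.mp ?_⟩
    refine eq_zero_of_inner_eq_zero ha hb (by simp [hq, ha, hb]) hab ?_ ?_ ?_
    · rw [inner_sub_left, inner_add_left, real_inner_smul_left, real_inner_smul_left, hE,
        real_inner_comm a b, h, div_mul_cancel₀ _ hbb]
      simp
    · rw [inner_sub_left, inner_add_left, real_inner_smul_left, real_inner_smul_left, h,
        div_mul_cancel₀ _ hbb]
      simp
    · rw [inner_sub_left, inner_add_left, real_inner_smul_left, real_inner_smul_left, h₃, inner_cross_left,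
        inner_cross_right]
      simp
  have haa : a * a = ((-inner ℝ b b : ℝ) : ℍ[ℝ]) := by
    rw [← hE, inner_eq_components]; ext <;> simp [ha] <;> ring
  have hbb' : b * b = ((-inner ℝ b b : ℝ) : ℍ[ℝ]) := by
    rw [inner_eq_components]; ext <;> simp [hb] <;> ring
  have hba : b * a = -(a * b) := by
    have := mul_add_mul_eq ha hb
    rw [h] at this
    rw [eq_neg_iff_add_eq_zero, add_comm, this]; simp
  rw [inv_eq_neg_smul ha, inv_eq_neg_smul hb, hE]
  -- As `a` and `b` anticommute and `a² = b²` is real, `bab = -a b²` cancels `a³`, and `aba = -b a²`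
  -- cancels `b³`.
  have e1 : a * (s • a + t • b) * a + b * (s • a + t • b) * b = 0 := by
    have e2 : a * b * a = -(b * (a * a)) := by rw [← mul_assoc, hba]; simp
    have e3 : b * a * b = -(a * (b * b)) := by rw [hba]; simp [mul_assoc]
    simp only [mul_add, add_mul, mul_smul_comm, smul_mul_assoc, e2, e3]
    rw [mul_assoc a a a, mul_assoc b b b, haa, hbb']
    module
  rw [smul_mul_assoc, smul_mul_smul_comm, smul_mul_assoc, smul_mul_smul_comm, ← smul_add, e1,
    smul_zero]

/-! ### The Minkowski product -/

/-- The Minkowski product as a bilinear map. -/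
def minkB : Mat →ₗ[ℝ] Mat →ₗ[ℝ] ℝ :=
  LinearMap.mk₂ ℝ minkInner
    (by intro A B C; simp only [minkInner, add_mul, mul_add, smul_add, Matrix.add_apply,
          Quaternion.re_add]; ring)
    (by intro r A B; simp only [minkInner, smul_mul_assoc, mul_smul_comm, smul_add,
          Matrix.add_apply, Matrix.smul_apply, Quaternion.re_add, Quaternion.re_smul,
          smul_eq_mul]; ring)
    (by intro A B C; simp only [minkInner, add_mul, mul_add, smul_add, Matrix.add_apply,
          Quaternion.re_add]; ring)
    (by intro r A B; simp only [minkInner, smul_mul_assoc, mul_smul_comm, smul_add,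
          Matrix.add_apply, Matrix.smul_apply, Quaternion.re_add, Quaternion.re_smul,
          smul_eq_mul]; ring)

theorem minkB_apply (A B : Mat) : minkB A B = minkInner A B := rfl

theorem minkInner_comm (A B : Mat) : minkInner A B = minkInner B A := by
  simp only [minkInner, add_comm]

theorem minkInner_add_left (A B C : Mat) :
    minkInner (A + B) C = minkInner A C + minkInner B C := by
  simp only [← minkB_apply, map_add, LinearMap.add_apply]
theorem minkInner_add_right (A B C : Mat) :
    minkInner A (B + C) = minkInner A B + minkInner A C := by
  simp only [← minkB_apply, map_add]
theorem minkInner_smul_left (r : ℝ) (A B : Mat) : minkInner (r • A) B = r * minkInner A B := by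
  simp only [← minkB_apply, map_smul, LinearMap.smul_apply, smul_eq_mul]
theorem minkInner_smul_right (r : ℝ) (A B : Mat) : minkInner A (r • B) = r * minkInner A B := by
  simp only [← minkB_apply, map_smul, smul_eq_mul]
theorem minkInner_zero_right (A : Mat) : minkInner A 0 = 0 := by
  simp [← minkB_apply]

/-- The lift of a vector `y` at the point `x` of `Im ℍ` to a tangent vector of the light cone: the
derivative of `pointLift` at `x` in the direction `y`. -/
def tanLift (x y : ℍ[ℝ]) : Mat := !![y, -(y * x + x * y); 0, -y]

/-- Minus the polarisation of `a ↦ a²`, as a multiple of the point at infinity. -/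
def infLift (a b : ℍ[ℝ]) : Mat := !![0, -(a * b + b * a); 0, 0]

/-- The entry `y₀` of `Y ∈ ℝ^{4,1}`. -/
def lowerEntry (Y : Mat) : ℝ := (Y 1 0).re

/-- The imaginary part of `Y ∈ ℝ^{4,1}` after the translation that moves `x` to the origin. -/
def relPart (x : ℍ[ℝ]) (Y : Mat) : ℍ[ℝ] := Y 0 0 - lowerEntry Y • x

theorem pointLift_mem {x : ℍ[ℝ]} (hx : x.re = 0) : pointLift x ∈ R41 := by
  refine ⟨x, 1, inner ℝ x x, hx, ?_⟩
  have := mul_add_mul_eq hx hx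
  rw [pointLift, inner_eq_components]
  ext i j <;> fin_cases i <;> fin_cases j <;> simp [hx] <;> ring

theorem tanLift_mem {x y : ℍ[ℝ]} (hx : x.re = 0) (hy : y.re = 0) : tanLift x y ∈ R41 := by
  refine ⟨y, 0, 2 * inner ℝ y x, hy, ?_⟩
  rw [tanLift, mul_add_mul_eq hy hx]
  ext i j <;> fin_cases i <;> fin_cases j <;> simp

theorem relPart_re {x : ℍ[ℝ]} (hx : x.re = 0) {Y : Mat} (hY : Y ∈ R41) :
    (relPart x Y).re = 0 := by
  obtain ⟨y, a, b, hy, rfl⟩ := hY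
  simp [relPart, hx, hy]

theorem relPart_add (x : ℍ[ℝ]) (Y W : Mat) :
    relPart x (Y + W) = relPart x Y + relPart x W := by
  simp [relPart, lowerEntry, add_smul]; abel

theorem relPart_smul (x : ℍ[ℝ]) (r : ℝ) (Y : Mat) : relPart x (r • Y) = r • relPart x Y := by
  simp [relPart, lowerEntry, smul_sub, mul_smul]

theorem relPart_pointLift (x : ℍ[ℝ]) : relPart x (pointLift x) = 0 := by
  simp [relPart, lowerEntry, pointLift]

theorem relPart_tanLift (x y : ℍ[ℝ]) : relPart x (tanLift x y) = y := by
  simp [relPart, lowerEntry, tanLift]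

/-- After the translation taking `x` to the origin, `ℝ^{4,1}` is the orthogonal sum of `Im ℍ` and a
hyperbolic plane spanned by the null vectors for the origin and for infinity. On vectors orthogonal
to `pointLift x` the product is therefore the Euclidean one of the relative parts, which moves all
later orthogonality questions to `ℝ³`. -/
theorem minkInner_eq_inner_relPart {x : ℍ[ℝ]} (hx : x.re = 0) {Y W : Mat} (hY : Y ∈ R41)
    (hW : W ∈ R41) :
    minkInner Y W = inner ℝ (relPart x Y) (relPart x W) +
      lowerEntry Y * minkInner W (pointLift x) + lowerEntry W * minkInner Y (pointLift x) := by
  obtain ⟨y, a, b, hy, rfl⟩ := hY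
  obtain ⟨w, c, d, hw, rfl⟩ := hW
  simp [relPart, lowerEntry, inner_eq_components, minkInner, pointLift, hx, hy, hw]
  ring

theorem minkInner_pointLift_self (x : ℍ[ℝ]) : minkInner (pointLift x) (pointLift x) = 0 := by
  simp [minkInner, pointLift]

theorem minkInner_tanLift_pointLift (x y : ℍ[ℝ]) :
    minkInner (tanLift x y) (pointLift x) = 0 := by
  simp [minkInner, pointLift, tanLift]

theorem minkInner_tanLift {x y : ℍ[ℝ]} (hx : x.re = 0) (hy : y.re = 0) {Y : Mat} (hY : Y ∈ R41) :
    minkInner Y (tanLift x y) = inner ℝ (relPart x Y) y := by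
  rw [minkInner_eq_inner_relPart hx hY (tanLift_mem hx hy), relPart_tanLift,
    minkInner_tanLift_pointLift]
  simp [lowerEntry, tanLift]

theorem minkInner_infLift {a b : ℍ[ℝ]} (ha : a.re = 0) (hb : b.re = 0) {Y : Mat} (hY : Y ∈ R41) :
    minkInner Y (infLift a b) = -(lowerEntry Y * inner ℝ a b) := by
  obtain ⟨y, c, d, hy, rfl⟩ := hY
  rw [infLift, mul_add_mul_eq ha hb]
  simp [minkInner, lowerEntry]; ring

theorem eq_smul_pointLift {x : ℍ[ℝ]} (hx : x.re = 0) {Y : Mat} (hY : Y ∈ R41)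
    (h : minkInner Y (pointLift x) = 0) (h' : relPart x Y = 0) :
    Y = lowerEntry Y • pointLift x := by
  obtain ⟨y, a, b, hy, rfl⟩ := hY
  have hy' : y = a • x := by simpa [relPart, lowerEntry, sub_eq_zero] using h'
  subst hy'
  have hb : b = a * inner ℝ x x := by
    rw [inner_eq_components]
    simp [minkInner, pointLift, hx] at h ⊢
    linarith
  subst hb
  rw [inner_eq_components]
  ext i j <;> fin_cases i <;> fin_cases j <;>
    simp [lowerEntry, pointLift, hx] <;> first | ring1 | exact .inr (by ring)

theorem tanLift_smul (x y : ℍ[ℝ]) (r : ℝ) : tanLift x (r • y) = r • tanLift x y := by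
  refine Matrix.ext fun i j => ?_
  fin_cases i <;> fin_cases j <;> simp [tanLift]

/-- The value `(x η, -x η x; η, -η x)` of the form `τ` for the value `η` of `dx*`. -/
def tauValue (x η : ℍ[ℝ]) : Mat := !![x * η, -(x * η * x); η, -(η * x)]

set_option maxHeartbeats 1000000 in
-- The entrywise comparison expands quaternionic products into components.
theorem commutator_tauValue {x η : ℍ[ℝ]} (hx : x.re = 0) (hη : η.re = 0) {Y : Mat}
    (hY : Y ∈ R41) :
    Y * tauValue x η - tauValue x η * Y =
      (2 * minkInner Y (tanLift x η)) • pointLift x -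
        (2 * minkInner Y (pointLift x)) • tanLift x η := by
  obtain ⟨y, a, b, hy, rfl⟩ := hY
  ext i j <;> fin_cases i <;> fin_cases j <;>
    simp [tauValue, minkInner, tanLift, pointLift, hx, hy, hη] <;> ring

/-! ### Directional derivatives -/

section Calculus

variable {E F G : Type*} [NormedAddCommGroup E] [NormedSpace ℝ E] [NormedAddCommGroup F]
  [NormedSpace ℝ F] [NormedAddCommGroup G] [NormedSpace ℝ G] {U : Set (ℝ × ℝ)} {p : ℝ × ℝ}

/-- The derivative of `f` in the constant direction `w`. -/
def dd (w : ℝ × ℝ) (f : ℝ × ℝ → E) (p : ℝ × ℝ) : E := fderiv ℝ f p w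

theorem contDiffOn_dd (hU : IsOpen U) {f : ℝ × ℝ → E} (hf : ContDiffOn ℝ ∞ f U) (w : ℝ × ℝ) :
    ContDiffOn ℝ ∞ (dd w f) U :=
  (hf.fderiv_of_isOpen hU (by simp)).clm_apply contDiffOn_const

theorem differentiableAt_of_contDiffOn (hU : IsOpen U) {f : ℝ × ℝ → E} (hf : ContDiffOn ℝ ∞ f U)
    (hp : p ∈ U) : DifferentiableAt ℝ f p :=
  (hf.contDiffAt (hU.mem_nhds hp)).differentiableAt (by simp)

theorem dd_congr (hU : IsOpen U) {f g : ℝ × ℝ → E} (h : ∀ q ∈ U, f q = g q) (hp : p ∈ U)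
    (w : ℝ × ℝ) : dd w f p = dd w g p := by
  unfold dd
  rw [Filter.EventuallyEq.fderiv_eq (Filter.eventuallyEq_of_mem (hU.mem_nhds hp) h)]

theorem dd_const (w : ℝ × ℝ) (c : E) : dd w (fun _ => c) p = 0 := by
  simp [dd]

theorem dd_add (hU : IsOpen U) {f g : ℝ × ℝ → E} (hf : ContDiffOn ℝ ∞ f U)
    (hg : ContDiffOn ℝ ∞ g U) (hp : p ∈ U) (w : ℝ × ℝ) :
    dd w (fun q => f q + g q) p = dd w f p + dd w g p := by
  simp [dd, fderiv_fun_add (differentiableAt_of_contDiffOn hU hf hp)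
    (differentiableAt_of_contDiffOn hU hg hp)]

theorem dd_const_smul (hU : IsOpen U) {f : ℝ × ℝ → E} (hf : ContDiffOn ℝ ∞ f U) (hp : p ∈ U)
    (r : ℝ) (w : ℝ × ℝ) : dd w (fun q => r • f q) p = r • dd w f p := by
  simp [dd, fderiv_fun_const_smul (differentiableAt_of_contDiffOn hU hf hp)]

theorem dd_smul (hU : IsOpen U) {r : ℝ × ℝ → ℝ} {f : ℝ × ℝ → E} (hr : ContDiffOn ℝ ∞ r U)
    (hf : ContDiffOn ℝ ∞ f U) (hp : p ∈ U) (w : ℝ × ℝ) :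
    dd w (fun q => r q • f q) p = dd w r p • f p + r p • dd w f p := by
  simp [dd, fderiv_fun_smul (differentiableAt_of_contDiffOn hU hr hp)
    (differentiableAt_of_contDiffOn hU hf hp), add_comm]

theorem contDiffOn_linear [FiniteDimensional ℝ E] (L : E →ₗ[ℝ] F) {f : ℝ × ℝ → E}
    (hf : ContDiffOn ℝ ∞ f U) : ContDiffOn ℝ ∞ (fun q => L (f q)) U :=
  (LinearMap.toContinuousLinearMap L).contDiff.comp_contDiffOn hf

theorem dd_linear [FiniteDimensional ℝ E] (hU : IsOpen U) (L : E →ₗ[ℝ] F) {f : ℝ × ℝ → E}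
    (hf : ContDiffOn ℝ ∞ f U) (hp : p ∈ U) (w : ℝ × ℝ) :
    dd w (fun q => L (f q)) p = L (dd w f p) := by
  have := ((LinearMap.toContinuousLinearMap L).hasFDerivAt.comp p
    (differentiableAt_of_contDiffOn hU hf hp).hasFDerivAt).fderiv
  simpa [dd, Function.comp_def] using congrArg (fun l => l w) this

theorem contDiffOn_bilin [FiniteDimensional ℝ E] [FiniteDimensional ℝ F]
    (B : E →ₗ[ℝ] F →ₗ[ℝ] G) {f : ℝ × ℝ → E} {g : ℝ × ℝ → F}
    (hf : ContDiffOn ℝ ∞ f U) (hg : ContDiffOn ℝ ∞ g U) :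
    ContDiffOn ℝ ∞ (fun q => B (f q) (g q)) U :=
  (B.toContinuousBilinearMap.contDiff.comp_contDiffOn hf).clm_apply hg

theorem dd_bilin [FiniteDimensional ℝ E] [FiniteDimensional ℝ F] (hU : IsOpen U)
    (B : E →ₗ[ℝ] F →ₗ[ℝ] G) {f : ℝ × ℝ → E} {g : ℝ × ℝ → F}
    (hf : ContDiffOn ℝ ∞ f U) (hg : ContDiffOn ℝ ∞ g U) (hp : p ∈ U) (w : ℝ × ℝ) :
    dd w (fun q => B (f q) (g q)) p = B (dd w f p) (g p) + B (f p) (dd w g p) := by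
  have := (B.toContinuousBilinearMap.fderiv_of_bilinear (differentiableAt_of_contDiffOn hU hf hp)
    (differentiableAt_of_contDiffOn hU hg hp))
  simpa [dd, add_comm] using congrArg (fun l => l w) this

theorem dd_comm (hU : IsOpen U) {f : ℝ × ℝ → E} (hf : ContDiffOn ℝ ∞ f U) (hp : p ∈ U)
    (w w' : ℝ × ℝ) : dd w (dd w' f) p = dd w' (dd w f) p := by
  have hd : DifferentiableAt ℝ (fderiv ℝ f) p :=
    ((hf.fderiv_of_isOpen hU (m := ∞) (by simp)).contDiffAt (hU.mem_nhds hp)).differentiableAt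
      (by simp)
  have key : ∀ a b, dd a (dd b f) p = fderiv ℝ (fderiv ℝ f) p a b := by
    intro a b
    have := (hd.hasFDerivAt.clm_apply (hasFDerivAt_const b p)).fderiv
    unfold dd
    rw [this]; simp
  rw [key, key]
  exact ((hf.contDiffAt (hU.mem_nhds hp)).isSymmSndFDerivAt
    (by rw [minSmoothness_of_isRCLikeNormedField]; exact WithTop.coe_le_coe.mpr (le_top : (2 : ℕ∞) ≤ ⊤))) w w'

theorem dd_mem_submodule [FiniteDimensional ℝ E] (hU : IsOpen U) (S : Submodule ℝ E)
    {f : ℝ × ℝ → E} (hf : ContDiffOn ℝ ∞ f U) (hS : ∀ q ∈ U, f q ∈ S) (hp : p ∈ U)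
    (w : ℝ × ℝ) : dd w f p ∈ S := by
  obtain ⟨L, hL⟩ := S.exists_isCompl
  -- This is the projection onto the complement `L` with kernel `S`; it kills `f` and hence the
  -- derivative of `f`.
  let π : E →ₗ[ℝ] E := Submodule.projection L S hL.symm
  have hπ : ∀ y, π y = 0 ↔ y ∈ S := fun y => by
    simp [π]
  have h := dd_linear hU π hf hp w
  rw [dd_congr hU (g := fun _ => 0) (fun q hq => (hπ _).mpr (hS q hq)) hp, dd_const] at h
  exact (hπ _).mp h.symm

theorem exists_forall_eq_const (hU : IsOpen U) (hUc : IsConnected U) {f : ℝ × ℝ → ℝ}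
    (hf : ContDiffOn ℝ ∞ f U) (hu : ∀ q ∈ U, dd (1, 0) f q = 0)
    (hv : ∀ q ∈ U, dd (0, 1) f q = 0) : ∃ c, ∀ q ∈ U, f q = c := by
  refine hU.exists_is_const_of_fderiv_eq_zero hUc.isPreconnected
    (hf.differentiableOn (by simp)) fun q hq => ?_
  ext
  · simpa [dd] using hu q hq
  · simpa [dd] using hv q hq

theorem contDiffOn_minkInner {f g : ℝ × ℝ → Mat} (hf : ContDiffOn ℝ ∞ f U)
    (hg : ContDiffOn ℝ ∞ g U) : ContDiffOn ℝ ∞ (fun q => minkInner (f q) (g q)) U :=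
  contDiffOn_bilin minkB hf hg

theorem dd_minkInner (hU : IsOpen U) {f g : ℝ × ℝ → Mat} (hf : ContDiffOn ℝ ∞ f U)
    (hg : ContDiffOn ℝ ∞ g U) (hp : p ∈ U) (w : ℝ × ℝ) :
    dd w (fun q => minkInner (f q) (g q)) p =
      minkInner (dd w f p) (g p) + minkInner (f p) (dd w g p) :=
  dd_bilin hU minkB hf hg hp w

/-- Differentiation of a constant product. -/
theorem minkInner_dd_add_eq_zero (hU : IsOpen U) {f g : ℝ × ℝ → Mat} (hf : ContDiffOn ℝ ∞ f U)
    (hg : ContDiffOn ℝ ∞ g U) {c : ℝ} (h : ∀ q ∈ U, minkInner (f q) (g q) = c) (hp : p ∈ U)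
    (w : ℝ × ℝ) : minkInner (dd w f p) (g p) + minkInner (f p) (dd w g p) = 0 := by
  rw [← dd_minkInner hU hf hg hp, dd_congr hU h hp, dd_const]

end Calculus

/-! ### The lift of a surface to a space form -/

/-- The linear part `y ↦ (y, 0; 0, -y)` of `pointLift`. -/
def diagLift : ℍ[ℝ] →ₗ[ℝ] Mat where
  toFun y := !![y, 0; 0, -y]
  map_add' y z := by
    refine Matrix.ext fun i j => ?_
    fin_cases i <;> fin_cases j <;> simp [add_comm]
  map_smul' r y := by
    refine Matrix.ext fun i j => ?_
    fin_cases i <;> fin_cases j <;> simp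

/-- `infLift` as a bilinear map. -/
def infLiftB : ℍ[ℝ] →ₗ[ℝ] ℍ[ℝ] →ₗ[ℝ] Mat :=
  LinearMap.mk₂ ℝ infLift
    (fun a b c => Matrix.ext fun i j => by
      fin_cases i <;> fin_cases j <;> simp [infLift, mul_add, add_mul]; abel)
    (fun r a b => Matrix.ext fun i j => by
      fin_cases i <;> fin_cases j <;> simp [infLift])
    (fun a b c => Matrix.ext fun i j => by
      fin_cases i <;> fin_cases j <;> simp [infLift, mul_add, add_mul]; abel)
    (fun r a b => Matrix.ext fun i j => by
      fin_cases i <;> fin_cases j <;> simp [infLift])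

theorem infLift_comm (a b : ℍ[ℝ]) : infLift a b = infLift b a := by
  simp only [infLift, add_comm]

theorem tanLift_eq (x y : ℍ[ℝ]) : tanLift x y = diagLift y + infLiftB y x := by
  refine Matrix.ext fun i j => ?_
  fin_cases i <;> fin_cases j <;> simp [tanLift, diagLift, infLiftB, infLift]

/-- Splits the quadratic map into linear, bilinear and constant parts, so that its derivatives
follow from the rules for linear and bilinear maps. The factor `1 / 2` appears because `infLift x x`
contains `x²` twice. -/
theorem pointLift_eq (x : ℍ[ℝ]) :
    pointLift x = diagLift x + (1 / 2 : ℝ) • infLiftB x x + pointLift 0 := by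
  refine Matrix.ext fun i j => ?_
  fin_cases i <;> fin_cases j <;> simp [pointLift, diagLift, infLiftB, infLift]
  module

section

variable {U : Set (ℝ × ℝ)} {x : ℝ × ℝ → ℍ[ℝ]} {p : ℝ × ℝ}

theorem contDiffOn_pointLift (hx : ContDiffOn ℝ ∞ x U) :
    ContDiffOn ℝ ∞ (fun q => pointLift (x q)) U := by
  simp only [pointLift_eq (x _)]
  exact ((contDiffOn_linear diagLift hx).add
    ((contDiffOn_bilin infLiftB hx hx).const_smul _)).add contDiffOn_const

theorem dd_pointLift (hU : IsOpen U) (hx : ContDiffOn ℝ ∞ x U) (hp : p ∈ U) (w : ℝ × ℝ) :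
    dd w (fun q => pointLift (x q)) p = tanLift (x p) (dd w x p) := by
  have h₁ := contDiffOn_linear diagLift hx
  have h₂ := contDiffOn_bilin infLiftB hx hx
  simp only [pointLift_eq (x _)]
  rw [dd_add hU (h₁.add (h₂.const_smul _)) contDiffOn_const hp,
    dd_add hU h₁ (h₂.const_smul _) hp, dd_const_smul hU h₂ hp, dd_linear hU _ hx hp,
    dd_bilin hU _ hx hx hp, dd_const, tanLift_eq,
    show infLiftB (x p) (dd w x p) = infLiftB (dd w x p) (x p) from infLift_comm _ _]
  module

theorem dd_dd_pointLift (hU : IsOpen U) (hx : ContDiffOn ℝ ∞ x U) (hp : p ∈ U) (w w' : ℝ × ℝ) :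
    dd w (dd w' (fun q => pointLift (x q))) p =
      tanLift (x p) (dd w (dd w' x) p) + infLift (dd w' x p) (dd w x p) := by
  have hx' := contDiffOn_dd hU hx w'
  rw [dd_congr hU (fun q hq => dd_pointLift hU hx hq w') hp]
  simp only [tanLift_eq]
  rw [dd_add hU (contDiffOn_linear diagLift hx') (contDiffOn_bilin infLiftB hx' hx) hp,
    dd_linear hU _ hx' hp, dd_bilin hU _ hx' hx hp, add_assoc]
  rfl

theorem dd_re_eq_zero (hU : IsOpen U) (hx : ContDiffOn ℝ ∞ x U) (h : ∀ q ∈ U, (x q).re = 0)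
    (hp : p ∈ U) (w : ℝ × ℝ) : (dd w x p).re = 0 := by
  let S : Submodule ℝ ℍ[ℝ] :=
    { carrier := {y | y.re = 0}
      add_mem' := fun {a b} ha hb => by
        have ha : a.re = 0 := ha
        have hb : b.re = 0 := hb
        simp [ha, hb]
      zero_mem' := by simp
      smul_mem' := fun r a ha => by
        have ha : a.re = 0 := ha
        simp [ha] }
  exact dd_mem_submodule hU S hx h hp w

end

/-- The hypotheses on the surface, its coordinates and the space form. -/
structure IsSpaceFormSurface (U : Set (ℝ × ℝ)) (x : ℝ × ℝ → ℍ[ℝ]) (Q : Mat) : Prop where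
  isOpen : IsOpen U
  isothermic : IsIsothermicImmersion U x
  mem_Q : Q ∈ R41
  mem : ∀ p ∈ U, spaceFormLift Q (x p) ∈ spaceForm Q

namespace IsSpaceFormSurface

variable {U : Set (ℝ × ℝ)} {x : ℝ × ℝ → ℍ[ℝ]} {Q : Mat} (h : IsSpaceFormSurface U x Q)
  {p : ℝ × ℝ}

/-- The factor between the surface in the space form and `pointLift`. -/
def factor (Q : Mat) (x : ℝ × ℝ → ℍ[ℝ]) (p : ℝ × ℝ) : ℝ := -(minkInner (pointLift (x p)) Q)⁻¹

/-- The surface in the space form. -/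
def surf (Q : Mat) (x : ℝ × ℝ → ℍ[ℝ]) (p : ℝ × ℝ) : Mat := factor Q x p • pointLift (x p)

include h

theorem smooth : ContDiffOn ℝ ∞ x U := h.isothermic.smooth

theorem re_eq_zero (hp : p ∈ U) : (x p).re = 0 := h.isothermic.imaginary p hp

theorem dd_re (hp : p ∈ U) (w : ℝ × ℝ) : (dd w x p).re = 0 :=
  dd_re_eq_zero h.isOpen h.smooth h.isothermic.imaginary hp w

theorem dd_dd_re (hp : p ∈ U) (w w' : ℝ × ℝ) : (dd w (dd w' x) p).re = 0 :=
  dd_re_eq_zero h.isOpen (contDiffOn_dd h.isOpen h.smooth w') (fun _ hq => h.dd_re hq w') hp w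

theorem dd_ne_zero (hp : p ∈ U) {w : ℝ × ℝ} (hw : w ≠ 0) : dd w x p ≠ 0 := fun h0 =>
  hw (h.isothermic.immersion p hp (by rw [map_zero]; exact h0))

theorem inner_eq (hp : p ∈ U) :
    inner ℝ (dd (1, 0) x p) (dd (1, 0) x p) = inner ℝ (dd (0, 1) x p) (dd (0, 1) x p) := by
  have := h.isothermic.norm_eq p hp
  rw [real_inner_self_eq_norm_sq, real_inner_self_eq_norm_sq]
  exact congrArg (· ^ 2) this

theorem inner_eq_zero (hp : p ∈ U) : inner ℝ (dd (1, 0) x p) (dd (0, 1) x p) = 0 :=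
  h.isothermic.orthogonal p hp

theorem cross_ne_zero (hp : p ∈ U) : cross (dd (1, 0) x p) (dd (0, 1) x p) ≠ 0 := by
  rw [← inner_self_ne_zero (𝕜 := ℝ), inner_cross_self (h.dd_re hp _) (h.dd_re hp _),
    h.inner_eq_zero hp]
  simpa using ⟨h.dd_ne_zero hp (w := (1, 0)) (by simp), h.dd_ne_zero hp (w := (0, 1)) (by simp)⟩

theorem inner_dd_dd_cross (hp : p ∈ U) :
    inner ℝ (dd (1, 0) (dd (0, 1) x) p) (cross (dd (1, 0) x p) (dd (0, 1) x p)) = 0 := by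
  have := h.isothermic.curvatureLine p hp
  rw [euclNormal, real_inner_smul_right] at this
  exact (mul_eq_zero.mp this).resolve_left
    (inv_ne_zero (norm_ne_zero_iff.mpr (h.cross_ne_zero hp)))

theorem minkInner_surf_Q (hp : p ∈ U) : minkInner (surf Q x p) Q = -1 := (h.mem p hp).2

/-- Membership in the space form encodes `⟨x̂, Q⟩ ≠ 0`: if that product vanished, the convention
`0⁻¹ = 0` would give `0` here instead of `-1`. -/
theorem factor_mul (hp : p ∈ U) : factor Q x p * minkInner (pointLift (x p)) Q = -1 := by
  rw [← h.minkInner_surf_Q hp, surf, minkInner_smul_left]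

theorem factor_ne_zero (hp : p ∈ U) : factor Q x p ≠ 0 := fun h0 => by
  have := h.factor_mul hp
  rw [h0] at this; simp at this

theorem contDiffOn_lift : ContDiffOn ℝ ∞ (fun q => pointLift (x q)) U :=
  contDiffOn_pointLift h.smooth

theorem contDiffOn_factor : ContDiffOn ℝ ∞ (factor Q x) U := by
  refine ((contDiffOn_minkInner h.contDiffOn_lift contDiffOn_const).inv fun q hq h0 => ?_).neg
  have := h.factor_mul hq
  rw [h0] at this; simp at this

theorem contDiffOn_surf : ContDiffOn ℝ ∞ (surf Q x) U :=
  h.contDiffOn_factor.smul h.contDiffOn_lift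

theorem dd_surf (hp : p ∈ U) (w : ℝ × ℝ) :
    dd w (surf Q x) p =
      dd w (factor Q x) p • pointLift (x p) + factor Q x p • tanLift (x p) (dd w x p) := by
  unfold surf
  rw [dd_smul h.isOpen h.contDiffOn_factor h.contDiffOn_lift hp, dd_pointLift h.isOpen h.smooth hp]

theorem surf_mem (hp : p ∈ U) : surf Q x p ∈ R41 :=
  R41.smul_mem _ (pointLift_mem (h.re_eq_zero hp))

theorem dd_surf_mem (hp : p ∈ U) (w : ℝ × ℝ) : dd w (surf Q x) p ∈ R41 :=
  dd_mem_submodule h.isOpen R41 h.contDiffOn_surf (fun _ hq => h.surf_mem hq) hp w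

theorem minkInner_dd_surf_Q (hp : p ∈ U) (w : ℝ × ℝ) : minkInner (dd w (surf Q x) p) Q = 0 := by
  have := minkInner_dd_add_eq_zero h.isOpen h.contDiffOn_surf contDiffOn_const
    (fun q hq => h.minkInner_surf_Q hq) hp w
  rwa [dd_const, minkInner_zero_right, add_zero] at this

/-- Obtained by solving `⟨X_w, Q⟩ = 0` for the derivative of the factor, rather than by
differentiating the inverse. -/
theorem dd_factor (hp : p ∈ U) (w : ℝ × ℝ) :
    dd w (factor Q x) p = factor Q x p ^ 2 * minkInner Q (tanLift (x p) (dd w x p)) := by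
  have h₁ := h.minkInner_dd_surf_Q hp w
  rw [h.dd_surf hp, minkInner_add_left, minkInner_smul_left, minkInner_smul_left,
    minkInner_comm (tanLift _ _)] at h₁
  linear_combination dd w (factor Q x) p * h.factor_mul hp - factor Q x p * h₁

theorem minkInner_dd_surf_lift (hp : p ∈ U) (w : ℝ × ℝ) :
    minkInner (dd w (surf Q x) p) (pointLift (x p)) = 0 := by
  rw [h.dd_surf hp, minkInner_add_left, minkInner_smul_left, minkInner_smul_left,
    minkInner_pointLift_self, minkInner_tanLift_pointLift]
  simp

theorem relPart_dd_surf (hp : p ∈ U) (w : ℝ × ℝ) :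
    relPart (x p) (dd w (surf Q x) p) = factor Q x p • dd w x p := by
  rw [h.dd_surf hp, relPart_add, relPart_smul, relPart_smul, relPart_pointLift, relPart_tanLift]
  simp

/-- The induced metric is conformal to that of `x`: `X_w` is orthogonal to `x̂` and its relative
part is `x_w` times the factor. Hence `(u, v)` stay conformal coordinates for `X`. -/
theorem minkInner_dd_surf (hp : p ∈ U) (w w' : ℝ × ℝ) :
    minkInner (dd w (surf Q x) p) (dd w' (surf Q x) p) =
      factor Q x p ^ 2 * inner ℝ (dd w x p) (dd w' x p) := by
  rw [minkInner_eq_inner_relPart (h.re_eq_zero hp) (h.dd_surf_mem hp w) (h.dd_surf_mem hp w'),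
    h.minkInner_dd_surf_lift hp, h.minkInner_dd_surf_lift hp, h.relPart_dd_surf hp,
    h.relPart_dd_surf hp, real_inner_smul_left, real_inner_smul_right]
  ring

theorem minkInner_dd_surf_uv (hp : p ∈ U) :
    minkInner (dd (1, 0) (surf Q x) p) (dd (0, 1) (surf Q x) p) = 0 := by
  rw [h.minkInner_dd_surf hp, h.inner_eq_zero hp, mul_zero]

theorem minkInner_dd_surf_vv (hp : p ∈ U) :
    minkInner (dd (0, 1) (surf Q x) p) (dd (0, 1) (surf Q x) p) =
      minkInner (dd (1, 0) (surf Q x) p) (dd (1, 0) (surf Q x) p) := by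
  rw [h.minkInner_dd_surf hp, h.minkInner_dd_surf hp, h.inner_eq hp]

theorem minkInner_dd_surf_ne_zero (hp : p ∈ U) {w : ℝ × ℝ} (hw : w ≠ 0) :
    minkInner (dd w (surf Q x) p) (dd w (surf Q x) p) ≠ 0 := by
  rw [h.minkInner_dd_surf hp]
  exact mul_ne_zero (pow_ne_zero _ (h.factor_ne_zero hp))
    (inner_self_ne_zero.mpr (h.dd_ne_zero hp hw))

/-- A vector orthogonal to `X` is orthogonal to the light cone vector of `x`. -/
theorem minkInner_lift_of_surf (hp : p ∈ U) {Y : Mat} (hY : minkInner Y (surf Q x p) = 0) :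
    minkInner Y (pointLift (x p)) = 0 := by
  rw [surf, minkInner_smul_right] at hY
  exact (mul_eq_zero.mp hY).resolve_left (h.factor_ne_zero hp)

theorem minkInner_dd_surf_eq (hp : p ∈ U) {Y : Mat} (hY : Y ∈ R41)
    (h₀ : minkInner Y (pointLift (x p)) = 0) (w : ℝ × ℝ) :
    minkInner Y (dd w (surf Q x) p) = factor Q x p * inner ℝ (relPart (x p) Y) (dd w x p) := by
  rw [h.dd_surf hp, minkInner_add_right, minkInner_smul_right, minkInner_smul_right, h₀,
    minkInner_tanLift (h.re_eq_zero hp) (h.dd_re hp w) hY]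
  ring

theorem inner_relPart_eq_zero (hp : p ∈ U) {Y : Mat} (hY : Y ∈ R41)
    (h₀ : minkInner Y (surf Q x p) = 0) {w : ℝ × ℝ}
    (h₁ : minkInner Y (dd w (surf Q x) p) = 0) :
    inner ℝ (relPart (x p) Y) (dd w x p) = 0 := by
  rw [h.minkInner_dd_surf_eq hp hY (h.minkInner_lift_of_surf hp h₀)] at h₁
  exact (mul_eq_zero.mp h₁).resolve_left (h.factor_ne_zero hp)

/-- A vector orthogonal to `X`, `X_u` and `X_v` has its imaginary part along the normal of `x`. -/
theorem exists_relPart_eq (hp : p ∈ U) {Y : Mat} (hY : Y ∈ R41)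
    (h₀ : minkInner Y (surf Q x p) = 0) (hu : minkInner Y (dd (1, 0) (surf Q x) p) = 0)
    (hv : minkInner Y (dd (0, 1) (surf Q x) p) = 0) :
    ∃ s : ℝ, relPart (x p) Y = s • cross (dd (1, 0) x p) (dd (0, 1) x p) :=
  exists_eq_smul_cross (h.dd_re hp _) (h.dd_re hp _) (relPart_re (h.re_eq_zero hp) hY)
    (h.cross_ne_zero hp) (h.inner_relPart_eq_zero hp hY h₀ hu)
    (h.inner_relPart_eq_zero hp hY h₀ hv)

theorem minkInner_eq_inner (hp : p ∈ U) {Y W : Mat} (hY : Y ∈ R41) (hW : W ∈ R41)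
    (h₀ : minkInner Y (surf Q x p) = 0) (h₁ : minkInner W (surf Q x p) = 0) :
    minkInner Y W = inner ℝ (relPart (x p) Y) (relPart (x p) W) := by
  rw [minkInner_eq_inner_relPart (h.re_eq_zero hp) hY hW, h.minkInner_lift_of_surf hp h₀,
    h.minkInner_lift_of_surf hp h₁]
  ring

/-- Such a `Y` lies on the null line of `X`, and pairing with `Q` finds the coefficient because `⟨X,
Q⟩ = -1`. -/
theorem eq_smul_surf (hp : p ∈ U) {Y : Mat} (hY : Y ∈ R41)
    (h₀ : minkInner Y (surf Q x p) = 0) (h₁ : relPart (x p) Y = 0) :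
    Y = -minkInner Y Q • surf Q x p := by
  have h₂ := eq_smul_pointLift (h.re_eq_zero hp) hY (h.minkInner_lift_of_surf hp h₀) h₁
  have h₃ : minkInner Y Q = lowerEntry Y * minkInner (pointLift (x p)) Q := by
    conv_lhs => rw [h₂, minkInner_smul_left]
  have h₄ : -minkInner Y Q * factor Q x p = lowerEntry Y := by
    linear_combination -factor Q x p * h₃ - lowerEntry Y * h.factor_mul hp
  rw [surf, smul_smul, h₄]
  exact h₂

/-- `X`, `Q`, `X_u`, `X_v` and a normal vector span `ℝ^{4,1}`. -/
theorem eq_zero_of_orthogonal (hp : p ∈ U) {N V : Mat} (hN : N ∈ R41) (hV : V ∈ R41)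
    (hN₀ : minkInner N (surf Q x p) = 0) (hNu : minkInner N (dd (1, 0) (surf Q x) p) = 0)
    (hNv : minkInner N (dd (0, 1) (surf Q x) p) = 0) (hNN : minkInner N N = 1)
    (hV₀ : minkInner V (surf Q x p) = 0) (hVQ : minkInner V Q = 0)
    (hVu : minkInner V (dd (1, 0) (surf Q x) p) = 0)
    (hVv : minkInner V (dd (0, 1) (surf Q x) p) = 0) (hVN : minkInner V N = 0) : V = 0 := by
  obtain ⟨s, hs⟩ := h.exists_relPart_eq hp hN hN₀ hNu hNv
  obtain ⟨t, ht⟩ := h.exists_relPart_eq hp hV hV₀ hVu hVv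
  rw [h.minkInner_eq_inner hp hN hN hN₀ hN₀, hs, real_inner_smul_left, real_inner_smul_right] at hNN
  rw [h.minkInner_eq_inner hp hV hN hV₀ hN₀, hs, ht, real_inner_smul_left,
    real_inner_smul_right] at hVN
  -- With `c = x_u × x_v`, the relations are `s²|c|² = 1` and `t s |c|² = 0`.
  have ht0 : t = 0 := by linear_combination s * hVN - t * hNN
  rw [h.eq_smul_surf hp hV hV₀ (by rw [ht, ht0, zero_smul]), hVQ]
  simp

/-- The second fundamental form of `X` in terms of the second derivatives of `x`. -/
theorem minkInner_dd_dd_surf (hp : p ∈ U) {N : Mat} (hN : N ∈ R41) {w w' : ℝ × ℝ}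
    (h₀ : minkInner N (surf Q x p) = 0) (h₁ : minkInner N (dd w (surf Q x) p) = 0)
    (h₂ : minkInner N (dd w' (surf Q x) p) = 0) :
    minkInner (dd w (dd w' (surf Q x)) p) N =
      factor Q x p * (inner ℝ (dd w (dd w' x) p) (relPart (x p) N) -
        lowerEntry N * inner ℝ (dd w x p) (dd w' x p)) := by
  have hx := h.smooth
  have hU := h.isOpen
  have hf := h.contDiffOn_factor
  have hl := h.contDiffOn_lift
  have e : dd w (dd w' (surf Q x)) p =
      dd w (dd w' (factor Q x)) p • pointLift (x p) +
        dd w' (factor Q x) p • tanLift (x p) (dd w x p) +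
        (dd w (factor Q x) p • tanLift (x p) (dd w' x p) +
        factor Q x p • (tanLift (x p) (dd w (dd w' x) p) + infLift (dd w' x p) (dd w x p))) := by
    have hf' := contDiffOn_dd hU hf w'
    have hl' := contDiffOn_dd hU hl w'
    rw [dd_congr hU (g := fun q => dd w' (factor Q x) q • pointLift (x q) +
        factor Q x q • dd w' (fun q => pointLift (x q)) q)
        (show ∀ q ∈ U, dd w' (surf Q x) q = _ from fun q hq => dd_smul hU hf hl hq w') hp,
      dd_add hU (f := fun q => dd w' (factor Q x) q • pointLift (x q))
        (g := fun q => factor Q x q • dd w' (fun q => pointLift (x q)) q)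
        (hf'.smul hl) (hf.smul hl') hp, dd_smul hU hf' hl hp, dd_smul hU hf hl' hp,
      dd_dd_pointLift hU hx hp, dd_pointLift hU hx hp, dd_pointLift hU hx hp]
  have hxr := h.re_eq_zero hp
  -- Pairing with `N` kills the `pointLift` term and the lifts of first derivatives. The second
  -- derivative of `x` and the `infLift` term survive, so up to a factor the second fundamental form
  -- is the Euclidean one shifted by a multiple of the metric. This is why curvature lines and
  -- umbilics are the same for `X` and `x`.
  rw [minkInner_comm, e]
  simp only [minkInner_add_right, minkInner_smul_right]
  rw [h.minkInner_lift_of_surf hp h₀, minkInner_tanLift hxr (h.dd_re hp w) hN,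
    minkInner_tanLift hxr (h.dd_re hp w') hN, minkInner_tanLift hxr (h.dd_dd_re hp w w') hN,
    h.inner_relPart_eq_zero hp hN h₀ h₁, h.inner_relPart_eq_zero hp hN h₀ h₂,
    minkInner_infLift (h.dd_re hp w') (h.dd_re hp w) hN, real_inner_comm (dd w x p),
    real_inner_comm (dd w (dd w' x) p)]
  ring

/-- With `f` the factor, `x_w⁻¹ = -x_w / |x_w|²` and `⟨Q, x̂⟩ = -1 / f`, while `⟨Q, T⟩ = f_w / f²`
for the tangent lift `T` of `x_w`. The two terms of the rotation then combine to a multiple of `f_w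
x̂ + f T = X_w`. -/
theorem commutator_inv_dd (hp : p ∈ U) {w : ℝ × ℝ} (hw : w ≠ 0) :
    Q * tauValue (x p) (dd w x p)⁻¹ - tauValue (x p) (dd w x p)⁻¹ * Q =
      -(2 / minkInner (dd w (surf Q x) p) (dd w (surf Q x) p)) • dd w (surf Q x) p := by
  have hE : inner ℝ (dd w x p) (dd w x p) ≠ 0 := inner_self_ne_zero.mpr (h.dd_ne_zero hp hw)
  have hρ := h.factor_ne_zero hp
  have hm : minkInner Q (pointLift (x p)) = -(factor Q x p)⁻¹ := by
    rw [minkInner_comm]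
    field_simp
    linear_combination h.factor_mul hp
  rw [commutator_tauValue (h.re_eq_zero hp)
      (by rw [inv_eq_neg_smul (h.dd_re hp w)]; simp [h.dd_re hp w]) h.mem_Q,
    inv_eq_neg_smul (h.dd_re hp w), tanLift_smul, minkInner_smul_right, h.minkInner_dd_surf hp,
    h.dd_surf hp, h.dd_factor hp, hm, smul_add, smul_smul, smul_smul, smul_smul, sub_eq_add_neg,
    ← neg_smul]
  congr 2 <;> field_simp

end IsSpaceFormSurface

/-! ### Existence of Christoffel transforms -/

theorem differentiableOn_christoffelForm {U : Set (ℝ × ℝ)} {x : ℝ × ℝ → ℍ[ℝ]} {Q : Mat}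
    (h : IsSpaceFormSurface U x Q) : DifferentiableOn ℝ (christoffelForm x) U := by
  intro p hp
  have key : ∀ {w : ℝ × ℝ}, w ≠ 0 → DifferentiableAt ℝ (fun q => (dd w x q)⁻¹) p := fun hw =>
    ((hasFDerivAt_inv' (𝕜 := ℝ) (h.dd_ne_zero hp hw)).comp p (differentiableAt_of_contDiffOn
      h.isOpen (contDiffOn_dd h.isOpen h.smooth _) hp).hasFDerivAt).differentiableAt
  have hu := key (w := (1, 0)) (by simp)
  have hv := key (w := (0, 1)) (by simp)
  refine DifferentiableAt.differentiableWithinAt ?_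
  exact (((ContinuousLinearMap.smulRightL ℝ (ℝ × ℝ) ℍ[ℝ]
    (ContinuousLinearMap.fst ℝ ℝ ℝ)).differentiableAt.comp p hu).sub
    ((ContinuousLinearMap.smulRightL ℝ (ℝ × ℝ) ℍ[ℝ]
    (ContinuousLinearMap.snd ℝ ℝ ℝ)).differentiableAt.comp p hv))

theorem dd_inv_dd {U : Set (ℝ × ℝ)} {x : ℝ × ℝ → ℍ[ℝ]} {Q : Mat}
    (h : IsSpaceFormSurface U x Q) {p : ℝ × ℝ} (hp : p ∈ U) {w : ℝ × ℝ} (hw : w ≠ 0)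
    (w' : ℝ × ℝ) :
    dd w' (fun q => (dd w x q)⁻¹) p =
      -((dd w x p)⁻¹ * dd w' (dd w x) p * (dd w x p)⁻¹) := by
  have hd := (differentiableAt_of_contDiffOn h.isOpen (contDiffOn_dd h.isOpen h.smooth w) hp)
  have := ((hasFDerivAt_inv' (𝕜 := ℝ) (h.dd_ne_zero hp hw)).comp p hd.hasFDerivAt).fderiv
  simpa [dd, Function.comp_def] using congrArg (fun l => l w') this

/-- Closedness of the form. By bilinearity only the pair of coordinate directions matters, where it
reads `x_u⁻¹ x_uv x_u⁻¹ + x_v⁻¹ x_uv x_v⁻¹ = 0`. This holds because the curvature-line condition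
puts `x_uv` in the span of `x_u` and `x_v`. -/
theorem fderiv_christoffelForm_symm {U : Set (ℝ × ℝ)} {x : ℝ × ℝ → ℍ[ℝ]} {Q : Mat}
    (h : IsSpaceFormSurface U x Q) {p : ℝ × ℝ} (hp : p ∈ U) (w w' : ℝ × ℝ) :
    fderiv ℝ (christoffelForm x) p w w' = fderiv ℝ (christoffelForm x) p w' w := by
  have hω := (differentiableOn_christoffelForm h).differentiableAt (h.isOpen.mem_nhds hp)
  have key : ∀ a b, fderiv ℝ (christoffelForm x) p a b =
      dd a (fun q => christoffelForm x q b) p := by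
    intro a b
    have := (hω.hasFDerivAt.clm_apply (hasFDerivAt_const b p)).fderiv
    unfold dd
    rw [this]; simp
  have hx := h.smooth
  have hcl : fderiv ℝ (christoffelForm x) p (1, 0) (0, 1) =
      fderiv ℝ (christoffelForm x) p (0, 1) (1, 0) := by
    have e₁ : (fun q => christoffelForm x q (0, 1)) = fun q => -(dd (0, 1) x q)⁻¹ := by
      funext q; simp [christoffelForm, pdv, dd]
    have e₂ : (fun q => christoffelForm x q (1, 0)) = fun q => (dd (1, 0) x q)⁻¹ := by
      funext q; simp [christoffelForm, pdu, dd]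
    have e₃ : dd (1, 0) (fun q => -(dd (0, 1) x q)⁻¹) p =
        -dd (1, 0) (fun q => (dd (0, 1) x q)⁻¹) p := by
      simp [dd, fderiv_fun_neg]
    rw [key, key, e₁, e₂, e₃, dd_inv_dd h hp (by simp), dd_inv_dd h hp (by simp),
      dd_comm h.isOpen hx hp (0, 1) (1, 0), neg_neg, eq_neg_iff_add_eq_zero, add_comm]
    exact inv_mul_mul_inv_add (h.dd_re hp _) (h.dd_re hp _) (h.dd_dd_re hp _ _)
      (h.cross_ne_zero hp) (h.inner_eq hp) (h.inner_eq_zero hp) (h.inner_dd_dd_cross hp)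
  have hw : ∀ w : ℝ × ℝ, w = w.1 • ((1, 0) : ℝ × ℝ) + w.2 • ((0, 1) : ℝ × ℝ) := fun w => by
    ext <;> simp
  rw [hw w, hw w']
  simp only [map_add, map_smul, add_apply, smul_apply, hcl]
  module

/-- The Poincaré lemma on a ball gives a quaternionic primitive. Its imaginary part is still a
primitive, since the form takes imaginary values. -/
theorem exists_isChristoffelTransform {U : Set (ℝ × ℝ)} {x : ℝ × ℝ → ℍ[ℝ]} {Q : Mat}
    (h : IsSpaceFormSurface U x Q) {p : ℝ × ℝ} (hp : p ∈ U) :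
    ∃ V : Set (ℝ × ℝ), IsOpen V ∧ p ∈ V ∧ V ⊆ U ∧ ∃ xs, IsChristoffelTransform V x xs := by
  obtain ⟨ε, hε, hεU⟩ := Metric.isOpen_iff.mp h.isOpen p hp
  refine ⟨Metric.ball p ε, Metric.isOpen_ball, Metric.mem_ball_self hε, hεU, ?_⟩
  obtain ⟨f, hf⟩ := (convex_ball p ε).exists_forall_hasFDerivAt_of_fderiv_symmetric
    Metric.isOpen_ball ((differentiableOn_christoffelForm h).mono hεU)
    (fun a ha => fderiv_christoffelForm_symm h (hεU ha))
  let imL : ℍ[ℝ] →ₗ[ℝ] ℍ[ℝ] :=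
    { toFun := fun q => q.im
      map_add' := fun a b => Quaternion.im_add a b
      map_smul' := fun r a => by ext <;> simp }
  refine ⟨fun q => (f q).im, fun q hq => ⟨by simp, ?_⟩⟩
  have h₁ := (LinearMap.toContinuousLinearMap imL).hasFDerivAt.comp q (hf q hq)
  have h₂ : (LinearMap.toContinuousLinearMap imL).comp (christoffelForm x q) =
      christoffelForm x q := by
    have hre : ∀ w, ((dd w x q)⁻¹).im = (dd w x q)⁻¹ := fun w => by
      have := h.dd_re (hεU hq) w
      rw [inv_eq_neg_smul this]
      ext <;> simp [this]
    have hu := hre (1, 0)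
    have hv := hre (0, 1)
    ext1
    · refine ContinuousLinearMap.ext_ring ?_
      simpa [christoffelForm, imL, pdu, dd] using hu
    · refine ContinuousLinearMap.ext_ring ?_
      simpa [christoffelForm, imL, pdv, dd] using hv
  rw [h₂] at h₁
  exact h₁

/-! ### Linear conserved quantities in terms of the lift -/

theorem tauValue_add (x a b : ℍ[ℝ]) : tauValue x (a + b) = tauValue x a + tauValue x b := by
  refine Matrix.ext fun i j => ?_
  fin_cases i <;> fin_cases j <;> simp [tauValue, mul_add, add_mul, add_comm]

theorem tauValue_smul (x a : ℍ[ℝ]) (r : ℝ) : tauValue x (r • a) = r • tauValue x a := by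
  refine Matrix.ext fun i j => ?_
  fin_cases i <;> fin_cases j <;> simp [tauValue]

theorem tau_eq {V : Set (ℝ × ℝ)} {x xs : ℝ × ℝ → ℍ[ℝ]} (hxs : IsChristoffelTransform V x xs)
    {p : ℝ × ℝ} (hp : p ∈ V) (w : ℝ × ℝ) :
    tau x xs p w = w.1 • tauValue (x p) (dd (1, 0) x p)⁻¹ -
      w.2 • tauValue (x p) (dd (0, 1) x p)⁻¹ := by
  have e : fderiv ℝ xs p w = w.1 • (dd (1, 0) x p)⁻¹ + (-w.2) • (dd (0, 1) x p)⁻¹ := by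
    rw [(hxs p hp).2.fderiv]
    simp [christoffelForm, pdu, pdv, dd, sub_eq_add_neg]
  have e' : tau x xs p w = tauValue (x p) (fderiv ℝ xs p w) := rfl
  rw [e', e, tauValue_add, tauValue_smul, tauValue_smul, neg_smul, sub_eq_add_neg]

/-- The derivative of `Z` and the position of `Z`, as required of the linear conserved quantity
`Q + λ Z`. -/
structure IsDualField (U : Set (ℝ × ℝ)) (X Z : ℝ × ℝ → Mat) : Prop where
  smooth : ContDiffOn ℝ ∞ Z U
  mem : ∀ p ∈ U, Z p ∈ R41
  orthogonal : ∀ p ∈ U, minkInner (Z p) (X p) = 0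
  orthogonal_u : ∀ p ∈ U, minkInner (Z p) (dd (1, 0) X p) = 0
  orthogonal_v : ∀ p ∈ U, minkInner (Z p) (dd (0, 1) X p) = 0
  dd_u : ∀ p ∈ U, dd (1, 0) Z p =
    -(2 / minkInner (dd (1, 0) X p) (dd (1, 0) X p)) • dd (1, 0) X p
  dd_v : ∀ p ∈ U, dd (0, 1) Z p =
    (2 / minkInner (dd (0, 1) X p) (dd (0, 1) X p)) • dd (0, 1) X p

namespace IsSpaceFormSurface

variable {U : Set (ℝ × ℝ)} {x : ℝ × ℝ → ℍ[ℝ]} {Q : Mat} (h : IsSpaceFormSurface U x Q)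
  {p : ℝ × ℝ}

include h

theorem commutator_eq_zero_iff (hp : p ∈ U) {Y : Mat} (hY : Y ∈ R41) {w : ℝ × ℝ} (hw : w ≠ 0) :
    Y * tauValue (x p) (dd w x p)⁻¹ - tauValue (x p) (dd w x p)⁻¹ * Y = 0 ↔
      minkInner Y (surf Q x p) = 0 ∧ minkInner Y (dd w (surf Q x) p) = 0 := by
  have hx := h.re_eq_zero hp
  have hw0 := h.dd_ne_zero hp hw
  have hE : inner ℝ (dd w x p) (dd w x p) ≠ 0 := inner_self_ne_zero.mpr hw0
  have hρ := h.factor_ne_zero hp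
  rw [commutator_tauValue hx
      (by rw [inv_eq_neg_smul (h.dd_re hp w)]; simp [h.dd_re hp w]) hY,
    inv_eq_neg_smul (h.dd_re hp w), tanLift_smul, minkInner_smul_right]
  constructor
  · intro h0
    -- `pointLift` and `tanLift` are told apart by the lower left entry, which is `1` for the former
    -- and `0` for the latter. Once the first coefficient is zero, the upper left entry `x_w ≠ 0` of
    -- the latter settles the second.
    have h₁ := congrFun (congrFun h0 1) 0
    have h₂ : minkInner Y (tanLift (x p) (dd w x p)) = 0 := by
      have h₃ := congrArg (fun q : ℍ[ℝ] => q.re) h₁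
      simpa [pointLift, tanLift, hw0] using h₃
    rw [h₂] at h0
    have h₃ := congrFun (congrFun h0 0) 0
    have h₄ : minkInner Y (pointLift (x p)) = 0 := by
      simpa [pointLift, tanLift, hw0] using h₃
    refine ⟨by rw [surf, minkInner_smul_right, h₄, mul_zero], ?_⟩
    rw [h.dd_surf hp, minkInner_add_right, minkInner_smul_right, minkInner_smul_right, h₂, h₄]
    ring
  · rintro ⟨h₀, h₁⟩
    have h₂ := h.minkInner_lift_of_surf hp h₀
    rw [h₂, minkInner_tanLift hx (h.dd_re hp w) hY, h.inner_relPart_eq_zero hp hY h₀ h₁]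
    simp

theorem isLinearConservedQuantity_of_isDualField {Z : ℝ × ℝ → Mat}
    (hZ : IsDualField U (surf Q x) Z) : IsLinearConservedQuantity U x (fun _ => Q) Z where
  smooth_Q := contDiffOn_const
  smooth_Z := hZ.smooth
  mem_Q _ _ := h.mem_Q
  mem_Z := hZ.mem
  conserved p₀ hp₀ := by
    obtain ⟨V, hV, hpV, hVU, xs, hxs⟩ := exists_isChristoffelTransform h hp₀
    refine ⟨V, hV, hpV, hVU, xs, hxs, fun p hpV w l => ?_⟩
    have hp := hVU hpV
    have hu := (h.commutator_eq_zero_iff hp (hZ.mem p hp) (w := (1, 0)) (by simp)).mpr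
      ⟨hZ.orthogonal p hp, hZ.orthogonal_u p hp⟩
    have hv := (h.commutator_eq_zero_iff hp (hZ.mem p hp) (w := (0, 1)) (by simp)).mpr
      ⟨hZ.orthogonal p hp, hZ.orthogonal_v p hp⟩
    have hu' := h.commutator_inv_dd hp (w := (1, 0)) (by simp)
    have hv' := h.commutator_inv_dd hp (w := (0, 1)) (by simp)
    rw [← hZ.dd_u p hp] at hu'
    rw [neg_smul, ← hZ.dd_v p hp] at hv'
    have e₁ : fderiv ℝ (fun q => Q + l • Z q) p w = l • dd w Z p := by
      have := dd_add h.isOpen (f := fun _ => Q) contDiffOn_const (hZ.smooth.const_smul l) hp w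
      rw [dd_const, zero_add, dd_const_smul h.isOpen hZ.smooth hp] at this
      exact this
    have e₂ : dd w Z p = w.1 • dd (1, 0) Z p + w.2 • dd (0, 1) Z p := by
      have : w = w.1 • ((1, 0) : ℝ × ℝ) + w.2 • ((0, 1) : ℝ × ℝ) := by ext <;> simp
      conv_lhs => rw [this]
      simp only [dd, map_add, map_smul]
    rw [e₁, e₂, tau_eq hxs hpV]
    generalize tauValue (x p) (dd (1, 0) x p)⁻¹ = A at *
    generalize tauValue (x p) (dd (0, 1) x p)⁻¹ = B at *
    -- Sorted by powers of `l`: the linear terms give `dZ` and the quadratic ones vanish by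
    -- orthogonality.
    have e₃ : (Q + l • Z p) * (l • (w.1 • A - w.2 • B)) - l • (w.1 • A - w.2 • B) * (Q + l • Z p) =
        (l * w.1) • (Q * A - A * Q) - (l * w.2) • (Q * B - B * Q) +
        (l * l * w.1) • (Z p * A - A * Z p) - (l * l * w.2) • (Z p * B - B * Z p) := by
      simp only [add_mul, mul_add, mul_sub, sub_mul, smul_mul_assoc, mul_smul_comm]
      module
    rw [e₃, hu, hv, hu', hv']
    module

theorem isDualField_of_isLinearConservedQuantity {Z : ℝ × ℝ → Mat}
    (hZ : IsLinearConservedQuantity U x (fun _ => Q) Z) : IsDualField U (surf Q x) Z := by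
  have key : ∀ p ∈ U, ∀ w : ℝ × ℝ, ∃ A : Mat,
      A = w.1 • tauValue (x p) (dd (1, 0) x p)⁻¹ - w.2 • tauValue (x p) (dd (0, 1) x p)⁻¹ ∧
      Z p * A - A * Z p = 0 ∧ dd w Z p = Q * A - A * Q := by
    intro p hp w
    obtain ⟨V, -, hpV, -, xs, hxs, hc⟩ := hZ.conserved p hp
    have hl : ∀ l : ℝ, l • dd w Z p =
        (Q + l • Z p) * (l • tau x xs p w) - l • tau x xs p w * (Q + l • Z p) := by
      intro l
      rw [← hc p hpV w l]
      have := dd_add h.isOpen (f := fun _ => Q) contDiffOn_const (hZ.smooth_Z.const_smul l) hp w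
      rw [dd_const, zero_add, dd_const_smul h.isOpen hZ.smooth_Z hp] at this
      exact this.symm
    refine ⟨tau x xs p w, tau_eq hxs hpV w, ?_⟩
    generalize tau x xs p w = A at *
    have e : ∀ l : ℝ, (Q + l • Z p) * (l • A) - l • A * (Q + l • Z p) =
        l • (Q * A - A * Q) + (l * l) • (Z p * A - A * Z p) := by
      intro l
      simp only [add_mul, mul_add, smul_mul_assoc, mul_smul_comm]
      module
    -- The values `1` and `-1` of `λ` already separate the linear from the quadratic coefficient.
    have h₁ := (hl 1).trans (e 1)
    have h₂ := (hl (-1)).trans (e (-1))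
    constructor
    · linear_combination (norm := module) (-(1 / 2) : ℝ) • h₁ + (-(1 / 2) : ℝ) • h₂
    · linear_combination (norm := module) (1 / 2 : ℝ) • h₁ - (1 / 2 : ℝ) • h₂
  have key_u : ∀ p ∈ U, _ := fun p hp => key p hp (1, 0)
  have key_v : ∀ p ∈ U, _ := fun p hp => key p hp (0, 1)
  simp only [one_smul, zero_smul, sub_zero, exists_eq_left] at key_u
  simp only [one_smul, zero_smul, zero_sub, exists_eq_left, mul_neg, neg_mul, sub_neg_eq_add]
    at key_v
  have orth_u := fun p hp => (h.commutator_eq_zero_iff hp (hZ.mem_Z p hp) (w := (1, 0))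
    (by simp)).mp (key_u p hp).1
  have orth_v := fun p hp => (h.commutator_eq_zero_iff hp (hZ.mem_Z p hp) (w := (0, 1))
    (by simp)).mp (by rw [← neg_eq_zero, ← (key_v p hp).1]; abel)
  refine ⟨hZ.smooth_Z, hZ.mem_Z, fun p hp => (orth_u p hp).1, fun p hp => (orth_u p hp).2,
    fun p hp => (orth_v p hp).2, fun p hp => ?_, fun p hp => ?_⟩
  · rw [(key_u p hp).2, h.commutator_inv_dd hp (by simp)]
  · rw [(key_v p hp).2, ← neg_inj, ← neg_smul, ← h.commutator_inv_dd hp (by simp)]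
    abel

end IsSpaceFormSurface

/-! ### Constant mean curvature -/

namespace IsSpaceFormSurface

variable {U : Set (ℝ × ℝ)} {x : ℝ × ℝ → ℍ[ℝ]} {Q : Mat} (h : IsSpaceFormSurface U x Q)

include h

theorem meanCurvature_eq {p : ℝ × ℝ} (hp : p ∈ U) (N : ℝ × ℝ → Mat) :
    meanCurvature (surf Q x) N p =
      (minkInner (dd (1, 0) (dd (1, 0) (surf Q x)) p) (N p) +
        minkInner (dd (0, 1) (dd (0, 1) (surf Q x)) p) (N p)) /
        (2 * minkInner (dd (1, 0) (surf Q x) p) (dd (1, 0) (surf Q x) p)) := by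
  have hg := h.minkInner_dd_surf_ne_zero hp (w := (1, 0)) (by simp)
  have hv := h.minkInner_dd_surf_vv hp
  have huv := h.minkInner_dd_surf_uv hp
  -- `pdu` and `pdv` are by definition `dd (1, 0)` and `dd (0, 1)`.
  change (minkInner (dd (1, 0) (dd (1, 0) (surf Q x)) p) (N p) *
      minkInner (dd (0, 1) (surf Q x) p) (dd (0, 1) (surf Q x) p)
      - 2 * minkInner (dd (1, 0) (dd (0, 1) (surf Q x)) p) (N p) *
      minkInner (dd (1, 0) (surf Q x) p) (dd (0, 1) (surf Q x) p)
      + minkInner (dd (0, 1) (dd (0, 1) (surf Q x)) p) (N p) *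
      minkInner (dd (1, 0) (surf Q x) p) (dd (1, 0) (surf Q x) p)) /
    (2 * (minkInner (dd (1, 0) (surf Q x) p) (dd (1, 0) (surf Q x) p) *
      minkInner (dd (0, 1) (surf Q x) p) (dd (0, 1) (surf Q x) p)
      - minkInner (dd (1, 0) (surf Q x) p) (dd (0, 1) (surf Q x) p) ^ 2)) = _
  rw [hv, huv]
  field_simp
  ring

section Normal

variable {N : ℝ × ℝ → Mat} (hN : IsUnitNormal U Q (surf Q x) N) {p : ℝ × ℝ} (hp : p ∈ U)

include hN hp

/-- Both contributions vanish: `x_uv` has no component along the Euclidean normal, and `x_u ⊥ x_v`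
removes the shift by the metric. -/
theorem minkInner_dd_dd_surf_uv :
    minkInner (dd (1, 0) (dd (0, 1) (surf Q x)) p) (N p) = 0 := by
  obtain ⟨s, hs⟩ := h.exists_relPart_eq hp (hN.mem p hp) (hN.tangent p hp).1
    (hN.normal p hp).1 (hN.normal p hp).2
  rw [h.minkInner_dd_dd_surf hp (hN.mem p hp) (hN.tangent p hp).1 (hN.normal p hp).1
    (hN.normal p hp).2, hs, real_inner_smul_right, h.inner_dd_dd_cross hp, h.inner_eq_zero hp]
  ring

/-- Equal principal curvatures make a point umbilic. -/
theorem isUmbilic_of_eq (heq : minkInner (dd (1, 0) (dd (1, 0) (surf Q x)) p) (N p) =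
      minkInner (dd (0, 1) (dd (0, 1) (surf Q x)) p) (N p)) : IsUmbilic x p := by
  obtain ⟨s, hs⟩ := h.exists_relPart_eq hp (hN.mem p hp) (hN.tangent p hp).1
    (hN.normal p hp).1 (hN.normal p hp).2
  have hs0 : s ≠ 0 := by
    rintro rfl
    have := hN.unit p hp
    rw [h.minkInner_eq_inner hp (hN.mem p hp) (hN.mem p hp) (hN.tangent p hp).1
      (hN.tangent p hp).1, hs] at this
    simp at this
  rw [h.minkInner_dd_dd_surf hp (hN.mem p hp) (hN.tangent p hp).1 (hN.normal p hp).1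
    (hN.normal p hp).1, h.minkInner_dd_dd_surf hp (hN.mem p hp) (hN.tangent p hp).1
    (hN.normal p hp).2 (hN.normal p hp).2, hs, real_inner_smul_right, real_inner_smul_right,
    h.inner_eq hp] at heq
  have h₁ := mul_left_cancel₀ (h.factor_ne_zero hp) heq
  have h₂ := mul_left_cancel₀ hs0 (sub_left_inj.mp h₁)
  have hE : inner ℝ (dd (0, 1) x p) (dd (0, 1) x p) ≠ 0 :=
    inner_self_ne_zero.mpr (h.dd_ne_zero hp (by simp))
  change ∃ k : ℝ,
    inner ℝ (dd (1, 0) (dd (1, 0) x) p) (euclNormal x p) =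
      k * inner ℝ (dd (1, 0) x p) (dd (1, 0) x p) ∧
    inner ℝ (dd (1, 0) (dd (0, 1) x) p) (euclNormal x p) =
      k * inner ℝ (dd (1, 0) x p) (dd (0, 1) x p) ∧
    inner ℝ (dd (0, 1) (dd (0, 1) x) p) (euclNormal x p) =
      k * inner ℝ (dd (0, 1) x p) (dd (0, 1) x p)
  have hn : euclNormal x p = ‖cross (dd (1, 0) x p) (dd (0, 1) x p)‖⁻¹ •
    cross (dd (1, 0) x p) (dd (0, 1) x p) := rfl
  refine ⟨inner ℝ (dd (0, 1) (dd (0, 1) x) p) (euclNormal x p) /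
    inner ℝ (dd (0, 1) x p) (dd (0, 1) x p), ?_, ?_, ?_⟩
  · rw [h.inner_eq hp, div_mul_cancel₀ _ hE, hn, real_inner_smul_right, real_inner_smul_right, h₂]
  · rw [h.inner_eq_zero hp, mul_zero]
    exact h.isothermic.curvatureLine p hp
  · rw [div_mul_cancel₀ _ hE]

/-- The coordinate directions are principal directions of the surface in the space form. -/
theorem dd_unitNormal_eq {w w' : ℝ × ℝ} (hw : w = (1, 0) ∧ w' = (0, 1) ∨ w = (0, 1) ∧ w' = (1, 0)) :
    dd w N p = -(minkInner (dd w (dd w (surf Q x)) p) (N p) /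
      minkInner (dd w (surf Q x) p) (dd w (surf Q x) p)) • dd w (surf Q x) p := by
  have hU := h.isOpen
  have hX := h.contDiffOn_surf
  have hNs : ∀ w, ∀ q ∈ U, w = (1, 0) ∨ w = (0, 1) →
      minkInner (N q) (dd w (surf Q x) q) = 0 := by
    rintro w q hq (rfl | rfl)
    · exact (hN.normal q hq).1
    · exact (hN.normal q hq).2
  have hw0 : w ≠ 0 := by rcases hw with ⟨rfl, rfl⟩ | ⟨rfl, rfl⟩ <;> simp
  have hw₁ : w = (1, 0) ∨ w = (0, 1) := by tauto
  have hw₂ : w' = (1, 0) ∨ w' = (0, 1) := by tauto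
  have hg := h.minkInner_dd_surf_ne_zero hp hw0
  have horth : minkInner (dd w (surf Q x) p) (dd w' (surf Q x) p) = 0 := by
    rcases hw with ⟨rfl, rfl⟩ | ⟨rfl, rfl⟩
    · exact h.minkInner_dd_surf_uv hp
    · rw [minkInner_comm]; exact h.minkInner_dd_surf_uv hp
  have hmix : minkInner (dd w (dd w' (surf Q x)) p) (N p) = 0 := by
    rcases hw with ⟨rfl, rfl⟩ | ⟨rfl, rfl⟩
    · exact h.minkInner_dd_dd_surf_uv hN hp
    · rw [dd_comm hU hX hp]; exact h.minkInner_dd_dd_surf_uv hN hp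
  have e₀ : minkInner (dd w N p) (surf Q x p) = 0 := by
    have := minkInner_dd_add_eq_zero hU hN.smooth hX (fun q hq => (hN.tangent q hq).1) hp w
    rwa [hNs w p hp hw₁, add_zero] at this
  have eQ : minkInner (dd w N p) Q = 0 := by
    have := minkInner_dd_add_eq_zero hU hN.smooth contDiffOn_const
      (fun q hq => (hN.tangent q hq).2) hp w
    rwa [dd_const, minkInner_zero_right, add_zero] at this
  have eN : minkInner (dd w N p) (N p) = 0 := by
    have := minkInner_dd_add_eq_zero hU hN.smooth hN.smooth hN.unit hp w
    rw [minkInner_comm (N p)] at this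
    linarith
  have e₁ : ∀ w', (w' = (1, 0) ∨ w' = (0, 1)) → minkInner (dd w N p) (dd w' (surf Q x) p) =
      -minkInner (dd w (dd w' (surf Q x)) p) (N p) := by
    intro w' hw'
    have := minkInner_dd_add_eq_zero hU hN.smooth (contDiffOn_dd hU hX w')
      (fun q hq => hNs w' q hq hw') hp w
    rw [minkInner_comm (N p)] at this
    linarith
  set k := minkInner (dd w (dd w (surf Q x)) p) (N p) /
      minkInner (dd w (surf Q x) p) (dd w (surf Q x) p) with hk
  have ew : minkInner (dd w N p + k • dd w (surf Q x) p) (dd w (surf Q x) p) = 0 := by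
    rw [minkInner_add_left, minkInner_smul_left, e₁ w hw₁, hk, div_mul_cancel₀ _ hg]
    ring
  have ew' : minkInner (dd w N p + k • dd w (surf Q x) p) (dd w' (surf Q x) p) = 0 := by
    rw [minkInner_add_left, minkInner_smul_left, e₁ w' hw₂, hmix, horth]
    ring
  have hdX : minkInner (dd w (surf Q x) p) (surf Q x p) = 0 := by
    rw [surf, minkInner_smul_right, h.minkInner_dd_surf_lift hp, mul_zero]
  have huv : minkInner (dd w N p + k • dd w (surf Q x) p) (dd (1, 0) (surf Q x) p) = 0 ∧
      minkInner (dd w N p + k • dd w (surf Q x) p) (dd (0, 1) (surf Q x) p) = 0 := by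
    rcases hw with ⟨rfl, rfl⟩ | ⟨rfl, rfl⟩
    · exact ⟨ew, ew'⟩
    · exact ⟨ew', ew⟩
  -- The vector is orthogonal to all of `X`, `Q`, `X_u`, `X_v` and `N`, which span `ℝ^{4,1}`.
  have hV : dd w N p + k • dd w (surf Q x) p = 0 := by
    refine h.eq_zero_of_orthogonal hp (hN.mem p hp) (R41.add_mem
      (dd_mem_submodule hU R41 hN.smooth hN.mem hp w) (R41.smul_mem _ (h.dd_surf_mem hp w)))
      (hN.tangent p hp).1 (hN.normal p hp).1 (hN.normal p hp).2 (hN.unit p hp) ?_ ?_ huv.1 huv.2 ?_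
    · rw [minkInner_add_left, minkInner_smul_left, e₀, hdX]; ring
    · rw [minkInner_add_left, minkInner_smul_left, eQ, h.minkInner_dd_surf_Q hp]; ring
    · rw [minkInner_add_left, minkInner_smul_left, eN, minkInner_comm, hNs w p hp hw₁]; ring
  rw [neg_smul]
  exact eq_neg_of_add_eq_zero_left hV

end Normal

/-- If `Y_u` and `Y_v` are opposite multiples of `X_u` and `X_v`, then `⟨Y_v, X_v⟩` is constant. -/
theorem exists_minkInner_dd_eq_const (hUc : IsConnected U) {Y : ℝ × ℝ → Mat}
    (hY : ContDiffOn ℝ ∞ Y U) {μ : ℝ × ℝ → ℝ}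
    (hYu : ∀ p ∈ U, dd (1, 0) Y p = -μ p • dd (1, 0) (surf Q x) p)
    (hYv : ∀ p ∈ U, dd (0, 1) Y p = μ p • dd (0, 1) (surf Q x) p) :
    ∃ m : ℝ, ∀ p ∈ U, μ p * minkInner (dd (0, 1) (surf Q x) p) (dd (0, 1) (surf Q x) p) = m := by
  have hU := h.isOpen
  have hX := h.contDiffOn_surf
  have hXu := contDiffOn_dd hU hX (1, 0)
  have hXv := contDiffOn_dd hU hX (0, 1)
  have hYu' := contDiffOn_dd hU hY (1, 0)
  have hYv' := contDiffOn_dd hU hY (0, 1)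
  have hXuv := fun p hp => h.minkInner_dd_surf_uv (p := p) hp
  have e₁ : ∀ p ∈ U, minkInner (dd (0, 1) Y p) (dd (0, 1) (surf Q x) p) =
      μ p * minkInner (dd (0, 1) (surf Q x) p) (dd (0, 1) (surf Q x) p) := fun p hp => by
    rw [hYv p hp, minkInner_smul_left]
  have e₂ : ∀ p ∈ U, minkInner (dd (0, 1) Y p) (dd (0, 1) (surf Q x) p) =
      (-1 : ℝ) * minkInner (dd (1, 0) Y p) (dd (1, 0) (surf Q x) p) := fun p hp => by
    rw [e₁ p hp, hYu p hp, minkInner_smul_left, h.minkInner_dd_surf_vv hp]; ring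
  have e₃ : ∀ p ∈ U, minkInner (dd (1, 0) Y p) (dd (0, 1) (surf Q x) p) = 0 := fun p hp => by
    rw [hYu p hp, minkInner_smul_left, hXuv p hp, mul_zero]
  have e₄ : ∀ p ∈ U, minkInner (dd (0, 1) Y p) (dd (1, 0) (surf Q x) p) = 0 := fun p hp => by
    rw [hYv p hp, minkInner_smul_left, minkInner_comm, hXuv p hp, mul_zero]
  suffices hm : ∃ m : ℝ, ∀ p ∈ U, minkInner (dd (0, 1) Y p) (dd (0, 1) (surf Q x) p) = m from
    hm.imp fun m hm p hp => by rw [← e₁ p hp, hm p hp]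
  refine exists_forall_eq_const hU hUc (contDiffOn_minkInner hYv' hXv)
    (fun p hp => ?_) (fun p hp => ?_)
  -- The symmetry of `Y_uv` takes the place of the Codazzi equations. Differentiating `⟨Y_u, X_v⟩ =
  -- 0` and `⟨X_u, X_v⟩ = 0` in `v` gives `⟨Y_uv, X_v⟩ = -μ⟨X_uv, X_v⟩`, which cancels `⟨Y_v,
  -- X_uv⟩`. The function `μ` is never differentiated.
  · have d₁ := minkInner_dd_add_eq_zero hU hYu' hXv e₃ hp (0, 1)
    have d₂ := minkInner_dd_add_eq_zero hU hXu hXv hXuv hp (0, 1)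
    rw [dd_minkInner hU hYv' hXv hp, dd_comm hU hY hp (1, 0) (0, 1)]
    rw [hYu p hp, minkInner_smul_left] at d₁
    rw [dd_comm hU hX hp (0, 1) (1, 0)] at d₂
    rw [hYv p hp, minkInner_smul_left, minkInner_comm (dd (0, 1) (surf Q x) p)]
    linear_combination d₁ + μ p * d₂
  -- By conformality the function also equals `-⟨Y_u, X_u⟩`, and the same argument applies with `u`
  -- and `v` exchanged.
  · have d₁ := minkInner_dd_add_eq_zero hU hYv' hXu e₄ hp (1, 0)
    have d₂ := minkInner_dd_add_eq_zero hU hXu hXv hXuv hp (1, 0)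
    rw [dd_congr hU e₂ hp, show dd (0, 1) (fun q => (-1 : ℝ) * minkInner (dd (1, 0) Y q)
        (dd (1, 0) (surf Q x) q)) p = (-1 : ℝ) • dd (0, 1) (fun q => minkInner (dd (1, 0) Y q)
        (dd (1, 0) (surf Q x) q)) p from
        dd_const_smul hU (contDiffOn_minkInner hYu' hXu) hp (-1) (0, 1),
      dd_minkInner hU hYu' hXu hp, dd_comm hU hY hp (0, 1) (1, 0),
      dd_comm hU hX hp (0, 1) (1, 0), smul_eq_mul]
    rw [hYv p hp, minkInner_smul_left] at d₁
    rw [hYu p hp, minkInner_smul_left,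
      minkInner_comm (dd (1, 0) (surf Q x) p) (dd (1, 0) (dd (0, 1) (surf Q x)) p)]
    rw [minkInner_comm (dd (1, 0) (surf Q x) p)] at d₂
    rw [minkInner_comm (dd (0, 1) (surf Q x) p)] at d₁
    linear_combination -d₁ + μ p * d₂

theorem exists_isDualField (hUc : IsConnected U) (humb : ∀ p ∈ U, ¬ IsUmbilic x p)
    (hH : HasConstantMeanCurvature U Q (surf Q x)) : ∃ Z, IsDualField U (surf Q x) Z := by
  obtain ⟨N, hN, c, hc⟩ := hH
  have hU := h.isOpen
  have hX := h.contDiffOn_surf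
  let g : ℝ × ℝ → ℝ := fun p => minkInner (dd (1, 0) (surf Q x) p) (dd (1, 0) (surf Q x) p)
  let k₁ : ℝ × ℝ → ℝ := fun p => minkInner (dd (1, 0) (dd (1, 0) (surf Q x)) p) (N p) / g p
  let k₂ : ℝ × ℝ → ℝ := fun p => minkInner (dd (0, 1) (dd (0, 1) (surf Q x)) p) (N p) / g p
  have hg : ∀ p ∈ U, g p ≠ 0 := fun p hp => h.minkInner_dd_surf_ne_zero hp (by simp)
  have hk : ∀ p ∈ U, k₁ p + k₂ p = 2 * c := fun p hp => by
    have h₁ := hg p hp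
    rw [← hc p hp, h.meanCurvature_eq hp]
    simp only [k₁, k₂, g] at h₁ ⊢
    field_simp
  let Y : ℝ × ℝ → Mat := fun p => N p + c • surf Q x p
  have hY : ContDiffOn ℝ ∞ Y U := hN.smooth.add (hX.const_smul c)
  have hdY : ∀ p ∈ U, ∀ w, dd w Y p = dd w N p + c • dd w (surf Q x) p := fun p hp w => by
    rw [dd_add hU hN.smooth (g := fun q => c • surf Q x q) (hX.const_smul c) hp,
      dd_const_smul hU hX hp]
  have hYu : ∀ p ∈ U, dd (1, 0) Y p = -(k₁ p - c) • dd (1, 0) (surf Q x) p := fun p hp => by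
    rw [hdY p hp, h.dd_unitNormal_eq hN hp (w' := (0, 1)) (by simp)]
    change -k₁ p • _ + _ = _
    module
  have hYv : ∀ p ∈ U, dd (0, 1) Y p = (k₁ p - c) • dd (0, 1) (surf Q x) p := fun p hp => by
    rw [hdY p hp, h.dd_unitNormal_eq hN hp (w' := (1, 0)) (by simp), h.minkInner_dd_surf_vv hp,
      show k₁ p - c = -k₂ p + c by linear_combination hk p hp]
    change -k₂ p • _ + _ = _
    module
  obtain ⟨m, hm⟩ := h.exists_minkInner_dd_eq_const hUc hY hYu hYv
  have hm' : ∀ p ∈ U, (k₁ p - c) * g p = m := fun p hp => by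
    rw [← hm p hp, h.minkInner_dd_surf_vv hp]
  -- If `m = 0`, then `k₁ = c`, and `k₁ + k₂ = 2c` makes the two principal curvatures equal.
  have hm0 : m ≠ 0 := by
    rintro rfl
    obtain ⟨p, hp⟩ := hUc.nonempty
    have h₁ := (mul_eq_zero.mp (hm' p hp)).resolve_right (hg p hp)
    have h₂ : k₁ p = k₂ p := by linear_combination 2 * h₁ - hk p hp
    exact humb p hp (h.isUmbilic_of_eq hN hp ((div_left_inj' (hg p hp)).mp h₂))
  have hcoef : ∀ p ∈ U, 2 / m * (k₁ p - c) = 2 / g p := fun p hp => by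
    have := hg p hp
    field_simp
    linear_combination hm' p hp
  have hdX : ∀ p ∈ U, ∀ w, minkInner (surf Q x p) (dd w (surf Q x) p) = 0 := fun p hp w => by
    rw [minkInner_comm, surf, minkInner_smul_right, h.minkInner_dd_surf_lift hp, mul_zero]
  refine ⟨fun p => (2 / m) • Y p, hY.const_smul _, fun p hp => R41.smul_mem _
    (R41.add_mem (hN.mem p hp) (R41.smul_mem _ (h.surf_mem hp))), fun p hp => ?_, fun p hp => ?_,
    fun p hp => ?_, fun p hp => ?_, fun p hp => ?_⟩
  · rw [minkInner_smul_left, minkInner_add_left, minkInner_smul_left, (hN.tangent p hp).1,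
      show minkInner (surf Q x p) (surf Q x p) = 0 from (h.mem p hp).1.2]
    ring
  · rw [minkInner_smul_left, minkInner_add_left, minkInner_smul_left, hdX p hp]
    have := (hN.normal p hp).1
    change minkInner (N p) (dd (1, 0) (surf Q x) p) = 0 at this
    rw [this]; ring
  · rw [minkInner_smul_left, minkInner_add_left, minkInner_smul_left, hdX p hp]
    have := (hN.normal p hp).2
    change minkInner (N p) (dd (0, 1) (surf Q x) p) = 0 at this
    rw [this]; ring
  · rw [dd_const_smul hU hY hp, hYu p hp, smul_smul, mul_neg, hcoef p hp]
  · rw [dd_const_smul hU hY hp, hYv p hp, smul_smul, hcoef p hp, h.minkInner_dd_surf_vv hp]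

theorem hasConstantMeanCurvature_of_isDualField (hUc : IsConnected U) {Z : ℝ × ℝ → Mat}
    (hZ : IsDualField U (surf Q x) Z) : HasConstantMeanCurvature U Q (surf Q x) := by
  have hU := h.isOpen
  have hX := h.contDiffOn_surf
  have hXX : ∀ p ∈ U, minkInner (surf Q x p) (surf Q x p) = 0 := fun p hp => (h.mem p hp).1.2
  have hdX : ∀ p ∈ U, ∀ w, minkInner (surf Q x p) (dd w (surf Q x) p) = 0 := fun p hp w => by
    rw [minkInner_comm, surf, minkInner_smul_right, h.minkInner_dd_surf_lift hp, mul_zero]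
  have hg := fun p hp => h.minkInner_dd_surf_ne_zero (p := p) hp (w := (1, 0)) (by simp)
  -- The derivatives of `Z` are multiples of `X_u` and `X_v`, to which both `Z` and `Q` are
  -- orthogonal.
  obtain ⟨k, hk⟩ : ∃ k, ∀ p ∈ U, minkInner (Z p) (Z p) = k := by
    refine exists_forall_eq_const hU hUc (contDiffOn_minkInner hZ.smooth hZ.smooth)
      (fun p hp => ?_) (fun p hp => ?_)
    · rw [dd_minkInner hU hZ.smooth hZ.smooth hp, minkInner_comm (dd _ _ _), hZ.dd_u p hp,
        minkInner_smul_right, hZ.orthogonal_u p hp]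
      ring
    · rw [dd_minkInner hU hZ.smooth hZ.smooth hp, minkInner_comm (dd _ _ _), hZ.dd_v p hp,
        minkInner_smul_right, hZ.orthogonal_v p hp]
      ring
  obtain ⟨b, hb⟩ : ∃ b, ∀ p ∈ U, minkInner (Z p) Q = b := by
    refine exists_forall_eq_const hU hUc (contDiffOn_minkInner hZ.smooth contDiffOn_const)
      (fun p hp => ?_) (fun p hp => ?_)
    · rw [dd_minkInner hU hZ.smooth contDiffOn_const hp, hZ.dd_u p hp, dd_const,
        minkInner_zero_right, minkInner_smul_left, h.minkInner_dd_surf_Q hp]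
      ring
    · rw [dd_minkInner hU hZ.smooth contDiffOn_const hp, hZ.dd_v p hp, dd_const,
        minkInner_zero_right, minkInner_smul_left, h.minkInner_dd_surf_Q hp]
      ring
  have hkn : ∀ p ∈ U, k = inner ℝ (relPart (x p) (Z p)) (relPart (x p) (Z p)) := fun p hp => by
    rw [← hk p hp, h.minkInner_eq_inner hp (hZ.mem p hp) (hZ.mem p hp) (hZ.orthogonal p hp)
      (hZ.orthogonal p hp)]
  obtain ⟨p₀, hp₀⟩ := hUc.nonempty
  -- `k` is the squared Euclidean length of the relative part of `Z`. If it vanished, `Z = -bX`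
  -- would have both derivatives equal to `-b` times those of `X`, against the opposite signs in the
  -- dual field.
  have hk0 : 0 < k := by
    refine lt_of_le_of_ne (by rw [hkn p₀ hp₀]; exact real_inner_self_nonneg) fun h0 => ?_
    have hZX : ∀ p ∈ U, Z p = -b • surf Q x p := fun p hp => by
      rw [← hb p hp]
      exact h.eq_smul_surf hp (hZ.mem p hp) (hZ.orthogonal p hp)
        (inner_self_eq_zero.mp (by rw [← hkn p hp, h0]))
    have hdZ : ∀ w, dd w Z p₀ = -b • dd w (surf Q x) p₀ := fun w => by
      rw [dd_congr hU hZX hp₀, dd_const_smul hU hX hp₀]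
    have hu := congrArg (minkInner · (dd (1, 0) (surf Q x) p₀))
      ((hdZ (1, 0)).symm.trans (hZ.dd_u p₀ hp₀))
    have hv := congrArg (minkInner · (dd (0, 1) (surf Q x) p₀))
      ((hdZ (0, 1)).symm.trans (hZ.dd_v p₀ hp₀))
    have hg₀ := hg p₀ hp₀
    simp only [minkInner_smul_left, h.minkInner_dd_surf_vv hp₀] at hu hv
    rw [neg_mul (2 / _), div_mul_cancel₀ _ hg₀] at hu
    rw [div_mul_cancel₀ _ hg₀] at hv
    linarith
  set r : ℝ := (Real.sqrt k)⁻¹ with hr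
  have hrk : r * (r * k) = 1 := by
    have hs : Real.sqrt k ≠ 0 := (Real.sqrt_pos.mpr hk0).ne'
    rw [hr]; field_simp
    rw [Real.sq_sqrt hk0.le]
  -- Adding `bX` makes the field orthogonal to `Q`, as `⟨X, Q⟩ = -1`. It leaves `⟨Z, Z⟩ = k`
  -- unchanged, since `X` is null and orthogonal to `Z`.
  let Y : ℝ × ℝ → Mat := fun p => Z p + b • surf Q x p
  have hY : ContDiffOn ℝ ∞ Y U := hZ.smooth.add (hX.const_smul b)
  have hYX : ∀ p ∈ U, ∀ W, minkInner (r • Y p) W =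
      r * (minkInner (Z p) W + b * minkInner (surf Q x p) W) := fun p _ W => by
    rw [minkInner_smul_left, minkInner_add_left, minkInner_smul_left]
  have hdY : ∀ p ∈ U, ∀ w, dd w (fun q => r • Y q) p =
      r • (dd w Z p + b • dd w (surf Q x) p) := fun p hp w => by
    rw [dd_const_smul hU hY hp, dd_add hU hZ.smooth (g := fun q => b • surf Q x q)
      (hX.const_smul b) hp, dd_const_smul hU hX hp]
  have hN : IsUnitNormal U Q (surf Q x) (fun p => r • Y p) := by
    refine ⟨hY.const_smul r, fun p hp => R41.smul_mem _ (R41.add_mem (hZ.mem p hp)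
      (R41.smul_mem _ (h.surf_mem hp))), fun p hp => ⟨?_, ?_⟩, fun p hp => ⟨?_, ?_⟩,
      fun p hp => ?_⟩
    · rw [hYX p hp, hZ.orthogonal p hp, hXX p hp]; ring
    · rw [hYX p hp, hb p hp, h.minkInner_surf_Q hp]; ring
    · change minkInner (r • Y p) (dd (1, 0) (surf Q x) p) = 0
      rw [hYX p hp, hZ.orthogonal_u p hp, hdX p hp]; ring
    · change minkInner (r • Y p) (dd (0, 1) (surf Q x) p) = 0
      rw [hYX p hp, hZ.orthogonal_v p hp, hdX p hp]; ring
    · rw [hYX p hp, minkInner_smul_right, minkInner_smul_right, minkInner_add_right,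
        minkInner_add_right, minkInner_smul_right, minkInner_smul_right, hk p hp, hXX p hp,
        minkInner_comm (surf Q x p), hZ.orthogonal p hp]
      linear_combination hrk
  -- With `g = |X_u|²`, the diagonal second fundamental form is `-r(-2 + bg)` and `-r(2 + bg)`; half
  -- the trace relative to `g` is `-rb`.
  refine ⟨_, hN, -(r * b), fun p hp => ?_⟩
  have hg₀ := hg p hp
  have e₁ : ∀ w, (∀ q ∈ U, minkInner (r • Y q) (dd w (surf Q x) q) = 0) →
      minkInner (dd w (dd w (surf Q x)) p) (r • Y p) =
      -(r * (minkInner (dd w Z p) (dd w (surf Q x) p) +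
        b * minkInner (dd w (surf Q x) p) (dd w (surf Q x) p))) := fun w hw => by
    have := minkInner_dd_add_eq_zero hU (hY.const_smul r) (contDiffOn_dd hU hX w) hw hp w
    rw [show dd w (fun q => r • Y q) p = _ from hdY p hp w, minkInner_smul_left, minkInner_add_left,
      minkInner_smul_left] at this
    rw [minkInner_comm]
    linear_combination this
  rw [h.meanCurvature_eq hp, e₁ _ fun q hq => (hN.normal q hq).1,
    e₁ _ fun q hq => (hN.normal q hq).2, hZ.dd_u p hp, hZ.dd_v p hp, minkInner_smul_left,
    minkInner_smul_left, h.minkInner_dd_surf_vv hp]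
  field_simp
  ring

end IsSpaceFormSurface

end Isothermic

end

theorem mainTheorem1 (U : Set (ℝ × ℝ)) (hU : IsOpen U) (hUc : IsConnected U)
    (x : ℝ × ℝ → ℍ[ℝ]) (hx : Isothermic.IsIsothermicImmersion U x)
    (humb : ∀ p ∈ U, ¬ Isothermic.IsUmbilic x p)
    (Q : Isothermic.Mat) (hQ : Q ∈ Isothermic.R41) (hQ0 : Q ≠ 0)
    (hM : ∀ p ∈ U, Isothermic.spaceFormLift Q (x p) ∈ Isothermic.spaceForm Q) :
    Isothermic.HasConstantMeanCurvature U Q (fun p => Isothermic.spaceFormLift Q (x p)) ↔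
      ∃ Z : ℝ × ℝ → Isothermic.Mat,
        Isothermic.IsLinearConservedQuantity U x (fun _ => Q) Z := by
  have h : Isothermic.IsSpaceFormSurface U x Q := ⟨hU, hx, hQ, hM⟩
  constructor
  · intro hH
    obtain ⟨Z, hZ⟩ := h.exists_isDualField hUc humb hH
    exact ⟨Z, h.isLinearConservedQuantity_of_isDualField hZ⟩
  · rintro ⟨Z, hZ⟩
    exact h.hasConstantMeanCurvature_of_isDualField hUc
      (h.isDualField_of_isLinearConservedQuantity hZ)
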